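/- **Setting.** Let $K$ be a finite geometric simplicial complex in $\mathbb{R}^2$ whose underlying space is the square $[0,1]^2$. Let $G$ be a connected nonempty finite graph embedded in the plane (finitely many points, joined by finitely many arcs, loops and multiple arcs allowed, that meet only at their endpoints). Let $\Omega\subseteq K$ be a subcomplex that is full (every simplex of $K$ all of whose vertices lie in $\Omega$ belongs to $\Omega$); its underlying space $|\Omega|$ contains $G$ and deformation retracts onto $G$, and every vertex of $\Omega$ is at distance at most $\omega$ from $G$. Let $\rho$ be a piecewise linear function on $K$ with $\rho(v)\in[\beta,\beta+\nu]$ at the vertices $v$ of $\Omega$ and $\rho(v)\in[0,\nu]$ at all other vertices of $K$, where $\beta>2\nu$. Let $\delta\in[\nu,\beta-\nu)$. **Reconstruction.** Put $f=-\rho$, and $f(\sigma)=\max_{v\in\sigma}f(v)$ for a simplex $\sigma$. Fix any lower-star filtration of $K$ with respect to $f$: the vertices $v_1,\dots,v_n$ are listed in non-decreasing order of $f$, and the simplices of $K$ are listed so that every face precedes its cofaces and the list is the concatenation of the lower stars of $v_1,\dots,v_n$, where the lower star of $v_i$ consists of the simplices whose last vertex is $v_i$. A pair $(\sigma,\tau)$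 of simplices is a persistence pair if adding $\tau$ destroys a homology class (with coefficients in $\mathbb{Z}/2$) created by adding $\sigma$; its persistence is $f(\tau)-f(\sigma)$, which is denoted $\mathrm{pers}(\sigma)$ and $\mathrm{pers}(\tau)$. An unpaired simplex has persistence $\infty$. The edges $e$ that form a pair $(v,e)$ with a vertex $v$ and have $\mathrm{pers}(e)\le\delta$ form, with all vertices of $K$, a forest. The sink of a tree of this forest is its vertex with the lowest value of $f$ (the first one in the filtration). The output $\hat G$ is the union, over all edges $e=\langle u,v\rangle$ of $K$ with $\mathrm{pers}(e)>\delta$, of $e$ and of the paths in the forest from $u$ and from $v$ to the sinks of their trees. **Theorem.** In this setting, $|\Omega|$ deformation retracts onto $G$; and if $G$ is not contractible (that is, if $G$ contains a cycle), then $|\Omega|$ also deformation retracts onto $\hat G$. Here a deformation retraction of $X$ onto $A\subseteq X$ is a continuous map $F\colon X\times[0,1]\to X$ with $F(x,0)=x$ and $F(x,1)\in A$ for all $x\in X$, and $F(a,t)=a$ for all $a\in A$ and $t\in[0,1]$. -/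

import Mathlib

noncomputable section

/-- The Euclidean plane. -/
abbrev Plane : Type := EuclideanSpace ℝ (Fin 2)

/-- The domain `[0,1]²`. -/
def unitSquare : Set Plane := {x | ∀ i, x i ∈ Set.Icc (0 : ℝ) 1}

/-- `N` deformation retracts onto `A ⊆ N`: there is a homotopy `F : N × [0,1] → N` from the identity
of `N` to a map into `A`, and `F` fixes every point of `A` at all times. -/
def DeformationRetractsOnto {X : Type*} [TopologicalSpace X] (N A : Set X) : Prop :=
  A ⊆ N ∧ ∃ F : C(N × unitInterval, N),
    (∀ x, F (x, 0) = x) ∧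
    (∀ x, (F (x, 1) : X) ∈ A) ∧
    (∀ a : N, (a : X) ∈ A → ∀ t, F (a, t) = a)

/-- `G` is a finite graph embedded in the plane: a finite set `V` of points (the vertices) together
with finitely many arcs (the edges; loops and multiple edges are allowed) that start and end in `V`
and whose open parts are simple, avoid `V`, and are pairwise disjoint. -/
def IsEmbeddedGraph (G : Set Plane) : Prop :=
  ∃ (V : Finset Plane) (n : ℕ) (γ : Fin n → C(unitInterval, Plane)),
    (∀ i, γ i 0 ∈ V ∧ γ i 1 ∈ V) ∧
    (∀ i, ∀ s ∈ Set.Ioo (0 : unitInterval) 1, γ i s ∉ V) ∧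
    (∀ i j, ∀ s ∈ Set.Ioo (0 : unitInterval) 1, ∀ t ∈ Set.Ioo (0 : unitInterval) 1,
      γ i s = γ j t → i = j ∧ s = t) ∧
    G = (V : Set Plane) ∪ ⋃ i, Set.range (γ i)

/-- `K` is a (finite) triangulation of the unit square. -/
structure IsTriangulationOfSquare (K : Geometry.SimplicialComplex ℝ Plane) : Prop where
  finite : K.faces.Finite
  space_eq : K.space = unitSquare

/-- The discrete noise model. The values at the vertices of the piecewise linear function `ρ` on `K`
form a `(β, ν, ω)`-approximation of `G`, with `N ⊆ K` as the `ω`-neighborhood of `G`. -/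
structure IsApproximation (K N : Geometry.SimplicialComplex ℝ Plane) (G : Set Plane)
    (ρ : Plane → ℝ) (β ν ω : ℝ) : Prop where
  /-- `N` is a subcomplex of `K`. -/
  subcomplex : N.faces ⊆ K.faces
  /-- `N` is full: a simplex of `K` all of whose vertices are in `N` is in `N`. -/
  full : ∀ s ∈ K.faces, (∀ v ∈ s, v ∈ N.vertices) → s ∈ N.faces
  graph_subset : G ⊆ N.space
  near : ∀ v ∈ N.vertices, Metric.infDist v G ≤ ω
  retracts : DeformationRetractsOnto N.space G
  density_inside : ∀ v ∈ N.vertices, ρ v ∈ Set.Icc β (β + ν)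
  density_outside : ∀ v ∈ K.vertices, v ∉ N.vertices → ρ v ∈ Set.Icc 0 ν
  gap : 2 * ν < β

/-! ### Simplicial chains with coefficients in `ℤ/2` -/

/-- Formal sums of finite sets of points (simplices) with coefficients in `ℤ/2`. -/
abbrev Chain : Type := Finset Plane →₀ ZMod 2

open Classical in
/-- The boundary of a simplex is the sum of its facets; the boundary of a vertex is zero. -/
def simplexBoundary (s : Finset Plane) : Chain :=
  if 2 ≤ s.card then ∑ v ∈ s, Finsupp.single (s.erase v) 1 else 0

/-- The boundary operator. -/
def boundaryMap : Chain →ₗ[ZMod 2] Chain := Finsupp.linearCombination (ZMod 2) simplexBoundary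

/-- The chains of the set of simplices `L` in dimension `k - 1`, i.e. on simplices with `k` vertices. -/
def chains (L : Set (Finset Plane)) (k : ℕ) : Submodule (ZMod 2) Chain :=
  Finsupp.supported (ZMod 2) (ZMod 2) {s | s ∈ L ∧ s.card = k}

/-- The cycles of `L` in dimension `k - 1`. -/
def cycles (L : Set (Finset Plane)) (k : ℕ) : Submodule (ZMod 2) Chain :=
  chains L k ⊓ LinearMap.ker boundaryMap

/-- The boundaries of `L` in dimension `k - 1`. -/
def boundaries (L : Set (Finset Plane)) (k : ℕ) : Submodule (ZMod 2) Chain :=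
  (chains L (k + 1)).map boundaryMap

/-! ### Lower-star filtrations and persistence -/

/-- The lower star of the vertex `v`: the simplices containing `v` in which `v` is the last vertex
in the order given by `pos`. -/
def lowerStar (K : Geometry.SimplicialComplex ℝ Plane) (pos : Finset Plane → ℕ) (v : Plane) :
    Set (Finset Plane) :=
  {s | s ∈ K.faces ∧ v ∈ s ∧ ∀ w ∈ s, pos {w} ≤ pos {v}}

/-- A lower-star filtration of `K` with respect to the vertex function `f`: the simplices are
ordered by their positions, faces come first, vertices are sorted in non-decreasing order of `f`
(ties are broken by the order), and the sequence is the concatenation of the lower stars of the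
vertices. -/
structure LowerStarFiltration (K : Geometry.SimplicialComplex ℝ Plane) (f : Plane → ℝ) where
  pos : Finset Plane → ℕ
  pos_injOn : Set.InjOn pos K.faces
  pos_face : ∀ s ∈ K.faces, ∀ t ∈ K.faces, s ⊂ t → pos s < pos t
  pos_vertex : ∀ v ∈ K.vertices, ∀ w ∈ K.vertices, f v < f w → pos {v} < pos {w}
  pos_lowerStar : ∀ v ∈ K.vertices, ∀ w ∈ K.vertices, pos {v} < pos {w} →
    ∀ s ∈ lowerStar K pos v, ∀ t ∈ lowerStar K pos w, pos s < pos t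

/-- The extension of `f` to simplices: the maximum of `f` over the vertices of `s`. -/
def simplexValue (f : Plane → ℝ) (s : Finset Plane) : ℝ := sSup (f '' (s : Set Plane))

namespace LowerStarFiltration

variable {K : Geometry.SimplicialComplex ℝ Plane} {f : Plane → ℝ}

/-- The subcomplex of all simplices up to and including `s`. -/
def upTo (S : LowerStarFiltration K f) (s : Finset Plane) : Set (Finset Plane) :=
  {r | r ∈ K.faces ∧ S.pos r ≤ S.pos s}

/-- The subcomplex of all simplices strictly before `s`. -/
def before (S : LowerStarFiltration K f) (s : Finset Plane) : Set (Finset Plane) :=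
  {r | r ∈ K.faces ∧ S.pos r < S.pos s}

/-- `(s, t)` is a persistence pair: some homology class that is created when `s` is added is
destroyed when `t` is added. That is, some cycle `z` of the complex ending at `s` is not homologous,
in the complex before `t`, to a cycle older than `s`, but it is in the complex ending at `t`. -/
def IsPair (S : LowerStarFiltration K f) (s t : Finset Plane) : Prop :=
  s ∈ K.faces ∧ t ∈ K.faces ∧ S.pos s < S.pos t ∧
    ∃ z ∈ cycles (S.upTo s) s.card,
      (∀ z' ∈ cycles (S.before s) s.card, z - z' ∉ boundaries (S.before t) s.card) ∧
      (∃ z' ∈ cycles (S.before s) s.card, z - z' ∈ boundaries (S.upTo t) s.card)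

/-- The persistence of the pair `(s, t)`. -/
def pairPersistence (_S : LowerStarFiltration K f) (s t : Finset Plane) : ℝ :=
  simplexValue f t - simplexValue f s

/-- `pers(s) > δ`: the persistence of the pair that contains `s` exceeds `δ`. An unpaired simplex
has infinite persistence. -/
def PersistenceExceeds (S : LowerStarFiltration K f) (δ : ℝ) (s : Finset Plane) : Prop :=
  (∀ t, S.IsPair s t → δ < S.pairPersistence s t) ∧
  (∀ t, S.IsPair t s → δ < S.pairPersistence t s)

/-! ### The reconstruction algorithm -/

open Classical in
/-- The spanning forest: its edges are those that form a persistence pair with a vertex, of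
persistence at most `δ`. -/
def forest (S : LowerStarFiltration K f) (δ : ℝ) : SimpleGraph Plane where
  Adj u v := u ≠ v ∧ ∃ w : Plane, S.IsPair {w} {u, v} ∧ S.pairPersistence {w} {u, v} ≤ δ
  symm := ⟨fun u v h => ⟨h.1.symm, by simpa only [Finset.pair_comm v u] using h.2⟩⟩
  loopless := ⟨fun _ h => h.1 rfl⟩

/-- `r` is the sink of the tree that contains `u`: its vertex with the lowest value of `f` (the
first one in the filtration, which sorts the vertices by `f`). -/
def IsSink (S : LowerStarFiltration K f) (δ : ℝ) (u r : Plane) : Prop :=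
  (S.forest δ).Reachable u r ∧ ∀ w, (S.forest δ).Reachable u w → S.pos {r} ≤ S.pos {w}

open Classical in
/-- The vertices and edges of the path in the forest from `u` to the sink of its tree. -/
def pathToSink (S : LowerStarFiltration K f) (δ : ℝ) (u : Plane) : Set (Finset Plane) :=
  {s | ∃ r, S.IsSink δ u r ∧ ∃ p : (S.forest δ).Walk u r, p.IsPath ∧
    ((∃ x ∈ p.support, s = {x}) ∨ (∃ x y, s(x, y) ∈ p.edges ∧ s = {x, y}))}

/-- The output of the algorithm: all edges `e` of `K` with `pers(e) > δ`, and the paths in the forest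
from their endpoints to the sinks. -/
def output (S : LowerStarFiltration K f) (δ : ℝ) : Set (Finset Plane) :=
  {s | ∃ e ∈ K.faces, e.card = 2 ∧ S.PersistenceExceeds δ e ∧
    (s = e ∨ ∃ u ∈ e, s ∈ S.pathToSink δ u)}

/-- The underlying space of the output graph. -/
def outputSpace (S : LowerStarFiltration K f) (δ : ℝ) : Set Plane :=
  ⋃ s ∈ S.output δ, convexHull ℝ (s : Set Plane)

end LowerStarFiltration

end

/-! The choice of δ separates two scales. On Ω (here `N`) the simplex values of f lie in [-β-ν, -β],
and on the other simplices in [-ν, 0]. So `N` is an initial segment of the filtration, and a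
persistence pair exceeds δ exactly when it is born in `N` and dies outside
(`IsApproximation.splitsAt`).

Two topological facts control the pairs. Since |N| is connected, no vertex-edge pair crosses from
`N` to its complement. Hence the forest consists of all negative edges of K, those that join two
components, and its part in `N` is a spanning tree. Since the square is convex, the first homology
of K vanishes (`cycles_le_boundaries`), so every cycle born outside `N` dies there. The edges with
persistence above δ are therefore exactly the edges of `N` that create a cycle and are not paired
inside `N`.

The tree and these edges form the critical graph Γ, whose inclusion in `N` is an isomorphism on
first homology mod 2: the last edge of a cycle in Γ would be paired inside `N` if the cycle bounded
there, and the other cycle-creating edges can be eliminated from a cycle by adding boundaries. In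
the plane this algebra already forces a collapse (`deformationRetractsOnto_graph`). A planar complex
has no 2-cycle, so the sum of its triangles has nonzero boundary; that boundary is not contained in
Γ, because no nonzero cycle of Γ bounds. An edge of it outside Γ lies in exactly one triangle, which
can be pushed in. Once the triangles are gone, only Γ remains.

Finally, Γ is the output with tree branches attached, and these are pruned towards the common sink.
If there is no critical edge, the pruning ends at a single point; then G would be contractible,
which is the excluded case. -/

noncomputable section

/-! ### Deformation retractions -/

namespace DeformationRetractsOnto

variable {X : Type*} [TopologicalSpace X] {N A B : Set X}

theorem refl (N : Set X) : DeformationRetractsOnto N N :=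
  ⟨subset_rfl, ⟨⟨Prod.fst, continuous_fst⟩, fun _ => rfl, fun x => x.2, fun _ _ _ => rfl⟩⟩

/-- The second homotopy is precomposed with the end map of the first, and the two are concatenated
as homotopies relative to `B`. -/
theorem trans (h₁ : DeformationRetractsOnto N A) (h₂ : DeformationRetractsOnto A B) :
    DeformationRetractsOnto N B := by
  obtain ⟨hAN, F, hF0, hF1, hFA⟩ := h₁
  obtain ⟨hBA, G, hG0, hG1, hGB⟩ := h₂
  have hr : Continuous fun x : N => (⟨F (x, 1), hF1 x⟩ : A) := by fun_prop
  let ι : A → N := fun a => ⟨a, hAN a.2⟩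
  have hι : Continuous ι := by fun_prop
  let r₁ : C(N, N) := ⟨fun x => F (x, 1), by fun_prop⟩
  let r₂ : C(N, N) := ⟨fun x => ι (G (⟨F (x, 1), hF1 x⟩, 1)), by fun_prop⟩
  let S : Set N := {x | (x : X) ∈ B}
  let H₁ : ContinuousMap.HomotopyRel (ContinuousMap.id N) r₁ S :=
    { toFun := fun p => F (p.2, p.1)
      map_zero_left := fun x => hF0 x
      map_one_left := fun x => rfl
      prop' := fun t x hx => hFA x (hBA hx) t }
  have hS : ∀ x (hx : x ∈ S) t, ι (G (⟨F (x, 1), hF1 x⟩, t)) = F (x, 1) := by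
    intro x hx t
    have e : (⟨F (x, 1), hF1 x⟩ : A) = ⟨x, hBA hx⟩ :=
      Subtype.ext (congrArg (Subtype.val : N → X) (hFA x (hBA hx) 1))
    rw [e, hGB ⟨x, hBA hx⟩ hx t, hFA x (hBA hx) 1]
  let H₂ : ContinuousMap.HomotopyRel r₁ r₂ S :=
    { toFun := fun p => ι (G (⟨F (p.2, 1), hF1 p.2⟩, p.1))
      continuous_toFun := by fun_prop
      map_zero_left := fun x => by rw [hG0]; rfl
      map_one_left := fun x => rfl
      prop' := fun t x hx => hS x hx t }
  let H := H₁.trans H₂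
  refine ⟨hBA.trans hAN, ⟨fun p => H (p.2, p.1), by fun_prop⟩, fun x => ?_, fun x => ?_,
    fun a ha t => ?_⟩
  · exact H.apply_zero x
  · have : H (1, x) = r₂ x := H.apply_one x
    change (H (1, x) : X) ∈ B
    rw [this]
    exact hG1 _
  · exact H.eq_fst t ha

/-- A deformation retract of a set that deformation retracts onto a point is contractible. -/
theorem contractibleSpace {p : X} (h : DeformationRetractsOnto N {p})
    (hA : DeformationRetractsOnto N A) : ContractibleSpace A := by
  obtain ⟨hpN, F, hF0, hF1, -⟩ := h
  obtain ⟨hAN, G, hG0, hG1, hGA⟩ := hA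
  rw [contractible_iff_id_nullhomotopic]
  have hpN' : p ∈ N := hpN rfl
  let ι : A → N := fun a => ⟨a, hAN a.2⟩
  have hι : Continuous ι := by fun_prop
  have hG : Continuous fun x : N => (⟨G (x, 1), hG1 x⟩ : A) := by fun_prop
  -- The contraction of `N` to `p`, started in `A` and followed at every time by the retraction `G
  -- (·, 1)` onto `A`.
  refine ⟨⟨G (⟨p, hpN'⟩, 1), hG1 _⟩, ⟨{
    toFun := fun q => ⟨G (F (ι q.2, q.1), 1), hG1 _⟩
    continuous_toFun := hG.comp (by fun_prop)
    map_zero_left := fun a => ?_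
    map_one_left := fun a => ?_ }⟩⟩
  · apply Subtype.ext
    change (G (F (ι a, 0), 1) : X) = a
    rw [hF0, hGA _ a.2]
  · apply Subtype.ext
    change (G (F (ι a, 1), 1) : X) = G (⟨p, hpN'⟩, 1)
    congr 3
    exact Subtype.ext (hF1 (ι a))

/-- Every point of `N` is joined to `A` by its own track under the homotopy. -/
theorem isPreconnected (h : DeformationRetractsOnto N A) (hA : IsPreconnected A) :
    IsPreconnected N := by
  obtain ⟨hAN, F, hF0, hF1, hFA⟩ := h
  rcases A.eq_empty_or_nonempty with rfl | ⟨a, ha⟩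
  · have : N = ∅ := Set.eq_empty_of_forall_notMem fun x hx => hF1 ⟨x, hx⟩
    rw [this]
    exact isPreconnected_empty
  refine isPreconnected_of_forall a fun y hy => ?_
  refine ⟨A ∪ Set.range fun t => (F (⟨y, hy⟩, t) : X), ?_, Or.inl ha, Or.inr ⟨0, ?_⟩, ?_⟩
  · rintro x (hx | ⟨t, rfl⟩)
    exacts [hAN hx, (F _).2]
  · simp only [hF0]
  · exact IsPreconnected.union _ (hF1 ⟨y, hy⟩) ⟨1, rfl⟩ hA
      (isPreconnected_range (by fun_prop))

theorem of_continuousOn (hAN : A ⊆ N) (F : X × unitInterval → X)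
    (hF : ContinuousOn F (N ×ˢ Set.univ)) (hFN : ∀ x ∈ N, ∀ t, F (x, t) ∈ N)
    (h0 : ∀ x ∈ N, F (x, 0) = x) (h1 : ∀ x ∈ N, F (x, 1) ∈ A)
    (hA : ∀ a ∈ A, ∀ t, F (a, t) = a) : DeformationRetractsOnto N A := by
  refine ⟨hAN, ⟨fun p => ⟨F (p.1, p.2), hFN _ p.1.2 _⟩, ?_⟩, fun x => Subtype.ext (h0 x x.2),
    fun x => h1 x x.2, fun a ha t => Subtype.ext (hA a ha t)⟩
  refine Continuous.subtype_mk ?_ _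
  exact hF.comp_continuous (f := fun p : N × unitInterval => ((p.1 : X), p.2)) (by fun_prop)
    fun p => ⟨p.1.2, trivial⟩

end DeformationRetractsOnto

/-! ### Elementary collapses -/

/-- The union of the simplices in a set of simplices. -/
def spaceOf (L : Set (Finset Plane)) : Set Plane := ⋃ s ∈ L, convexHull ℝ (s : Set Plane)

theorem mem_spaceOf {L : Set (Finset Plane)} {x : Plane} :
    x ∈ spaceOf L ↔ ∃ s ∈ L, x ∈ convexHull ℝ (s : Set Plane) := by
  simp [spaceOf]

theorem isClosed_convexHull_finset (s : Finset Plane) :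
    IsClosed (convexHull ℝ (s : Set Plane)) :=
  (s.finite_toSet.isCompact_convexHull ℝ).isClosed

theorem isClosed_spaceOf {L : Set (Finset Plane)} (hL : L.Finite) : IsClosed (spaceOf L) :=
  hL.isClosed_biUnion fun s _ => isClosed_convexHull_finset s

/-- Barycentric coordinates on an affinely independent set extend to continuous affine functions. -/
theorem AffineIndependent.exists_coord {τ : Finset Plane}
    (hτ : AffineIndependent ℝ ((↑) : τ → Plane)) :
    ∃ l : Plane → Plane →ᵃ[ℝ] ℝ, (∀ b, Continuous (l b)) ∧
      ∀ b ∈ τ, ∀ v ∈ τ, l b v = if v = b then 1 else 0 := by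
  obtain ⟨t, ht, hi, hs⟩ :=
    exists_subset_affineIndependent_affineSpan_eq_top (k := ℝ) (s := (τ : Set Plane)) hτ
  let B : AffineBasis t ℝ Plane := ⟨(↑), hi, by simpa using hs⟩
  classical
  refine ⟨fun b => if hb : b ∈ t then B.coord ⟨b, hb⟩ else 0, fun b => ?_, fun b hb v hv => ?_⟩
  · exact AffineMap.continuous_of_finiteDimensional _
  · have hbt := ht hb
    have hvt := ht hv
    simp only [hbt, dif_pos]
    have := B.coord_apply ⟨b, hbt⟩ ⟨v, hvt⟩
    change B.coord ⟨b, hbt⟩ v = _ at this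
    rw [this]
    simp [Subtype.ext_iff, eq_comm]

theorem affineMap_sum {τ : Finset Plane} {w : Plane → ℝ} (l : Plane →ᵃ[ℝ] ℝ)
    (hw : ∑ v ∈ τ, w v = 1) : l (∑ v ∈ τ, w v • v) = ∑ v ∈ τ, w v * l v := by
  have h : ∀ x, l x = l.linear x + l 0 := fun x => by
    have := l.map_vadd 0 x
    simpa using this
  rw [h, map_sum]
  simp only [map_smul, smul_eq_mul]
  have : ∀ v ∈ τ, w v * l v = w v * l.linear v + w v * l 0 := fun v _ => by rw [h v, mul_add]
  rw [Finset.sum_congr rfl this, Finset.sum_add_distrib, ← Finset.sum_mul, hw, one_mul]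

theorem mem_convexHull_iff_coord {τ : Finset Plane} {l : Plane → Plane →ᵃ[ℝ] ℝ}
    (hl : ∀ b ∈ τ, ∀ v ∈ τ, l b v = if v = b then 1 else 0) {x : Plane} :
    x ∈ convexHull ℝ (τ : Set Plane) ↔
      (∀ b ∈ τ, 0 ≤ l b x) ∧ ∑ b ∈ τ, l b x = 1 ∧ ∑ b ∈ τ, l b x • b = x := by
  rw [Finset.mem_convexHull']
  constructor
  · rintro ⟨w, hw0, hw1, rfl⟩
    have : ∀ b ∈ τ, l b (∑ v ∈ τ, w v • v) = w b := fun b hb => by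
      rw [affineMap_sum _ hw1, Finset.sum_eq_single_of_mem b hb]
      · simp [hl b hb b hb]
      · intro c hc hcb
        simp [hl b hb c hc, hcb]
    refine ⟨fun b hb => by rw [this b hb]; exact hw0 b hb, ?_, ?_⟩
    · rw [Finset.sum_congr rfl this, hw1]
    · exact Finset.sum_congr rfl fun b hb => by rw [this b hb]
  · rintro ⟨h0, h1, h2⟩
    exact ⟨fun b => l b x, h0, h1, h2⟩

theorem mem_convexHull_erase_iff_coord {τ : Finset Plane}
    {l : Plane → Plane →ᵃ[ℝ] ℝ}
    (hl : ∀ b ∈ τ, ∀ v ∈ τ, l b v = if v = b then 1 else 0) {x b : Plane} (hb : b ∈ τ)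
    (hx : x ∈ convexHull ℝ (τ : Set Plane)) :
    x ∈ convexHull ℝ ((τ.erase b : Finset Plane) : Set Plane) ↔ l b x = 0 := by
  have hl' : ∀ c ∈ τ.erase b, ∀ v ∈ τ.erase b, l c v = if v = c then 1 else 0 :=
    fun c hc v hv => hl c (Finset.mem_of_mem_erase hc) v (Finset.mem_of_mem_erase hv)
  rw [mem_convexHull_iff_coord hl']
  rw [mem_convexHull_iff_coord hl] at hx
  obtain ⟨h0, h1, h2⟩ := hx
  rw [← Finset.add_sum_erase _ _ hb] at h1 h2
  constructor
  · rintro ⟨-, h, -⟩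
    linarith
  · intro h
    rw [h] at h1 h2
    exact ⟨fun c hc => h0 c (Finset.mem_of_mem_erase hc), by simpa using h1, by simpa using h2⟩

/-- Pushing a simplex in from its free facet `τ.erase a` is a deformation retraction. -/
theorem deformationRetractsOnto_elementaryCollapse {K : Geometry.SimplicialComplex ℝ Plane}
    {L : Set (Finset Plane)} (hL : L.Finite) (hLK : L ⊆ K.faces) {τ : Finset Plane}
    (hτ : τ ∈ K.faces) {a : Plane} (ha : a ∈ τ) (hσ : (τ.erase a).Nonempty)
    (hfree : ∀ s ∈ L, ¬ τ.erase a ⊆ s) (hfacet : ∀ b ∈ τ.erase a, τ.erase b ∈ L) :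
    DeformationRetractsOnto (spaceOf (insert (τ.erase a) (insert τ L))) (spaceOf L) := by
  classical
  set σ := τ.erase a with hσdef
  obtain ⟨l, hlc, hl⟩ := (K.indep hτ).exists_coord
  have hστ : σ ⊆ τ := Finset.erase_subset _ _
  have hspace : spaceOf (insert σ (insert τ L)) = convexHull ℝ (τ : Set Plane) ∪ spaceOf L := by
    simp only [spaceOf, Set.biUnion_insert]
    rw [← Set.union_assoc, Set.union_eq_right.2 (convexHull_mono (by exact_mod_cast hστ))]
  -- The smallest barycentric coordinate at the vertices of the free facet: it tells how far a point
  -- can move before it reaches another facet of `τ`.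
  set m : Plane → ℝ := fun x => σ.inf' hσ fun b => l b x with hm
  have hmc : Continuous m := Continuous.finset_inf'_apply hσ fun b _ => hlc b
  have hmle : ∀ x, ∀ b ∈ σ, m x ≤ l b x := fun x b hb => Finset.inf'_le _ hb
  have hmex : ∀ x, ∃ b ∈ σ, m x = l b x := fun x => Finset.exists_mem_eq_inf' hσ _
  have hm0 : ∀ x ∈ convexHull ℝ (τ : Set Plane), 0 ≤ m x := fun x hx => by
    obtain ⟨b, hb, h⟩ := hmex x
    rw [h]
    exact ((mem_convexHull_iff_coord hl).1 hx).1 b (hστ hb)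
  -- A simplex of `L` misses some vertex `b` of the free facet. So it meets `τ` inside the facet
  -- opposite to `b`, where the coordinate of `b` vanishes.
  have hmL : ∀ x ∈ convexHull ℝ (τ : Set Plane), x ∈ spaceOf L → m x = 0 := by
    intro x hx hxL
    obtain ⟨s, hs, hxs⟩ := mem_spaceOf.1 hxL
    obtain ⟨b, hb, hbs⟩ := Finset.not_subset.1 (hfree s hs)
    have h1 : x ∈ convexHull ℝ ((τ.erase b : Finset Plane) : Set Plane) := by
      refine convexHull_mono ?_ (K.inter_subset_convexHull hτ (hLK hs) ⟨hx, hxs⟩)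
      rintro y ⟨hy, hys⟩
      simp only [Finset.coe_erase, Set.mem_sdiff, Finset.mem_coe, Set.mem_singleton_iff]
      exact ⟨hy, fun h => hbs (h ▸ hys)⟩
    rw [mem_convexHull_erase_iff_coord hl (hστ hb) hx] at h1
    exact le_antisymm (h1 ▸ hmle x b hb) (hm0 x hx)
  -- Moving along `w` lowers every coordinate in `σ` at rate 1 and raises that of `a` at rate
  -- `σ.card`, which keeps the sum equal to 1.
  set w : Plane := ∑ b ∈ σ, (a - b) with hw
  have hlw : ∀ c ∈ τ, (l c).linear w = if c = a then (σ.card : ℝ) else -1 := by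
    intro c hc
    have h : ∀ b ∈ σ, (l c).linear (a - b) = (if a = c then 1 else 0) - if b = c then 1 else 0 := by
      intro b hb
      rw [← vsub_eq_sub, AffineMap.linearMap_vsub, hl c hc a ha, hl c hc b (hστ hb), vsub_eq_sub]
    rw [hw, map_sum, Finset.sum_congr rfl h]
    by_cases hca : c = a
    · subst hca
      have h1 : ∀ b ∈ σ, ((1 : ℝ) - if b = c then 1 else 0) = 1 := fun b hb => by
        rw [if_neg (Finset.ne_of_mem_erase hb), sub_zero]
      simp only [if_true]
      rw [Finset.sum_congr rfl h1]
      simp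
    · have hcσ : c ∈ σ := Finset.mem_erase.2 ⟨hca, hc⟩
      simp [hca, Ne.symm hca, hcσ]
  -- The travel time extended by zero. It is continuous on the union of the two closed sets because
  -- `m` vanishes on their intersection.
  set μ : Plane → ℝ := (convexHull ℝ (τ : Set Plane)).piecewise m 0 with hμ
  have hμτ : ∀ x ∈ convexHull ℝ (τ : Set Plane), μ x = m x := fun x hx =>
    Set.piecewise_eq_of_mem _ _ _ hx
  have hμL : ∀ x ∈ spaceOf L, μ x = 0 := fun x hx => by
    by_cases h : x ∈ convexHull ℝ (τ : Set Plane)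
    · rw [hμτ x h, hmL x h hx]
    · exact Set.piecewise_eq_of_notMem _ _ _ h
  have hμc : ContinuousOn μ (convexHull ℝ (τ : Set Plane) ∪ spaceOf L) :=
    ContinuousOn.union_of_isClosed (hmc.continuousOn.congr hμτ)
      ((continuousOn_const (c := (0 : ℝ))).congr hμL) (isClosed_convexHull_finset τ)
      (isClosed_spaceOf hL)
  have hmem : ∀ x ∈ convexHull ℝ (τ : Set Plane), ∀ s : ℝ, 0 ≤ s → s ≤ 1 →
      x + (s * m x) • w ∈ convexHull ℝ (τ : Set Plane) ∧
        ∀ c ∈ σ, l c (x + (s * m x) • w) = l c x - s * m x := by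
    intro x hx s hs0 hs1
    have hlx : ∀ c, l c (x + (s * m x) • w) = l c x + s * m x * (l c).linear w := fun c => by
      have := (l c).map_vadd x ((s * m x) • w)
      rw [vadd_eq_add, vadd_eq_add, map_smul, smul_eq_mul] at this
      rw [add_comm x, this, add_comm]
    have hcσ : ∀ c ∈ σ, l c (x + (s * m x) • w) = l c x - s * m x := fun c hc => by
      rw [hlx, hlw c (hστ hc), if_neg (Finset.ne_of_mem_erase hc)]
      ring
    have hsm : 0 ≤ s * m x := mul_nonneg hs0 (hm0 x hx)
    have hca : l a (x + (s * m x) • w) = l a x + s * m x * σ.card := by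
      rw [hlx, hlw a ha, if_pos rfl]
    obtain ⟨h0, h1, h2⟩ := (mem_convexHull_iff_coord hl).1 hx
    refine ⟨(mem_convexHull_iff_coord hl).2 ⟨fun c hc => ?_, ?_, ?_⟩, hcσ⟩
    · by_cases hc' : c ∈ σ
      · rw [hcσ c hc', sub_nonneg]
        exact (mul_le_of_le_one_left (hm0 x hx) hs1).trans (hmle x c hc')
      · have : c = a := by
          by_contra h
          exact hc' (Finset.mem_erase.2 ⟨h, hc⟩)
        rw [this, hca]
        have := h0 a ha
        positivity
    · rw [← Finset.add_sum_erase _ _ ha] at h1 ⊢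
      rw [← hσdef] at h1 ⊢
      rw [hca, Finset.sum_congr rfl hcσ, Finset.sum_sub_distrib, Finset.sum_const, nsmul_eq_mul]
      linarith
    · have h3 : ∑ c ∈ σ, l c (x + (s * m x) • w) • c = ∑ c ∈ σ, (l c x • c - (s * m x) • c) :=
        Finset.sum_congr rfl fun c hc => by rw [hcσ c hc, sub_smul]
      rw [← Finset.add_sum_erase _ _ ha] at h2 ⊢
      rw [← hσdef] at h2 ⊢
      rw [hca, h3, Finset.sum_sub_distrib, ← Finset.smul_sum, add_smul]
      have h4 : w = (σ.card : ℝ) • a - ∑ c ∈ σ, c := by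
        rw [hw, Finset.sum_sub_distrib, Finset.sum_const, Nat.cast_smul_eq_nsmul]
      rw [h4, smul_sub, smul_smul]
      linear_combination (norm := module) h2
  rw [hspace]
  refine .of_continuousOn Set.subset_union_right
    (fun p => p.1 + ((p.2 : ℝ) * μ p.1) • w) ?_ ?_ ?_ ?_ ?_
  · have h1 : ContinuousOn (fun p : Plane × unitInterval => μ p.1)
        ((convexHull ℝ (τ : Set Plane) ∪ spaceOf L) ×ˢ Set.univ) :=
      hμc.comp continuousOn_fst fun p hp => hp.1
    exact continuousOn_fst.add
      (((continuous_subtype_val.comp continuous_snd).continuousOn.mul h1).smul continuousOn_const)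
  · rintro x (hx | hx) t
    · simp only [hμτ x hx]
      exact Or.inl (hmem x hx t t.2.1 t.2.2).1
    · simp only [hμL x hx, mul_zero, zero_smul, add_zero]
      exact Or.inr hx
  · intro x _
    simp
  · rintro x (hx | hx)
    · simp only [hμτ x hx]
      obtain ⟨h1, h2⟩ := hmem x hx 1 zero_le_one le_rfl
      obtain ⟨b, hb, hbm⟩ := hmex x
      have h3 := h2 b hb
      refine mem_spaceOf.2 ⟨τ.erase b, hfacet b hb, ?_⟩
      exact (mem_convexHull_erase_iff_coord hl (hστ hb) h1).2 (by rw [h3, hbm, one_mul, sub_self])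
    · simp only [hμL x hx, mul_zero, zero_smul, add_zero]
      exact hx
  · intro x hx t
    simp only [hμL x hx, mul_zero, zero_smul, add_zero]

/-! ### Chains, cycles and boundaries modulo 2 -/

theorem ZMod.eq_one_of_ne_zero_two {x : ZMod 2} (h : x ≠ 0) : x = 1 := by
  revert x; decide

theorem mem_chains {L : Set (Finset Plane)} {k : ℕ} {c : Chain} :
    c ∈ chains L k ↔ ∀ s, c s ≠ 0 → s ∈ L ∧ s.card = k := by
  simp only [chains, Finsupp.mem_supported, Set.subset_def, Finset.mem_coe, Finsupp.mem_support_iff,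
    Set.mem_ofPred_eq]

theorem single_mem_chains {L : Set (Finset Plane)} {k : ℕ} {s : Finset Plane} (hs : s ∈ L)
    (hk : s.card = k) (r : ZMod 2) : Finsupp.single s r ∈ chains L k := by
  refine mem_chains.2 fun t ht => ?_
  by_cases h : s = t
  · exact h ▸ ⟨hs, hk⟩
  · exact absurd (Finsupp.single_eq_of_ne (Ne.symm h)) ht

theorem chains_mono {L L' : Set (Finset Plane)} (h : L ⊆ L') (k : ℕ) : chains L k ≤ chains L' k :=
  fun _ hc => mem_chains.2 fun s hs => ⟨h (mem_chains.1 hc s hs).1, (mem_chains.1 hc s hs).2⟩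

theorem boundaries_mono {L L' : Set (Finset Plane)} (h : L ⊆ L') (k : ℕ) :
    boundaries L k ≤ boundaries L' k :=
  Submodule.map_mono (chains_mono h _)

theorem mem_boundaries {L : Set (Finset Plane)} {k : ℕ} {c : Chain} :
    c ∈ boundaries L k ↔ ∃ d ∈ chains L (k + 1), boundaryMap d = c :=
  Submodule.mem_map

theorem mem_cycles {L : Set (Finset Plane)} {k : ℕ} {c : Chain} :
    c ∈ cycles L k ↔ c ∈ chains L k ∧ boundaryMap c = 0 :=
  Iff.rfl

theorem boundaryMap_single (s : Finset Plane) :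
    boundaryMap (Finsupp.single s 1) = simplexBoundary s := by
  simp [boundaryMap]

theorem boundaryMap_eq_sum (c : Chain) :
    boundaryMap c = ∑ t ∈ c.support, c t • simplexBoundary t :=
  Finsupp.linearCombination_apply _ _

theorem simplexBoundary_of_card_le_one {s : Finset Plane} (h : s.card ≤ 1) :
    simplexBoundary s = 0 := by
  rw [simplexBoundary, if_neg (by omega)]

theorem simplexBoundary_pair {u v : Plane} (h : u ≠ v) :
    simplexBoundary {u, v} = Finsupp.single {u} 1 + Finsupp.single {v} 1 := by
  rw [simplexBoundary, if_pos (Finset.card_pair h).ge, Finset.sum_pair h, add_comm]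
  have h1 : ({u, v} : Finset Plane).erase u = {v} := by
    ext x; simp only [Finset.mem_erase, Finset.mem_insert, Finset.mem_singleton]; grind
  have h2 : ({u, v} : Finset Plane).erase v = {u} := by
    ext x; simp only [Finset.mem_erase, Finset.mem_insert, Finset.mem_singleton]; grind
  rw [h1, h2]

theorem simplexBoundary_triple {u v w : Plane} (huv : u ≠ v) (huw : u ≠ w) (hvw : v ≠ w) :
    simplexBoundary {u, v, w} =
      Finsupp.single {v, w} 1 + Finsupp.single {u, w} 1 + Finsupp.single {u, v} 1 := by
  rw [simplexBoundary, if_pos (by rw [Finset.card_eq_three.2 ⟨u, v, w, huv, huw, hvw, rfl⟩]; omega),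
    Finset.sum_insert (by simp [huv, huw]), Finset.sum_pair hvw, ← add_assoc]
  have h1 : ({u, v, w} : Finset Plane).erase u = {v, w} := by
    ext x; simp only [Finset.mem_erase, Finset.mem_insert, Finset.mem_singleton]; grind
  have h2 : ({u, v, w} : Finset Plane).erase v = {u, w} := by
    ext x; simp only [Finset.mem_erase, Finset.mem_insert, Finset.mem_singleton]; grind
  have h3 : ({u, v, w} : Finset Plane).erase w = {u, v} := by
    ext x; simp only [Finset.mem_erase, Finset.mem_insert, Finset.mem_singleton]; grind
  rw [h1, h2, h3]

theorem simplexBoundary_apply {s r : Finset Plane} (hs : 2 ≤ s.card) :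
    simplexBoundary s r = if r ⊆ s ∧ r.card + 1 = s.card then 1 else 0 := by
  rw [simplexBoundary, if_pos hs, Finsupp.finsetSum_apply]
  split_ifs with h
  · obtain ⟨a, ha⟩ : ∃ a, s \ r = {a} := Finset.card_eq_one.1 (by
      rw [Finset.card_sdiff_of_subset h.1]; omega)
    have has : a ∈ s ∧ a ∉ r := Finset.mem_sdiff.1 (ha ▸ Finset.mem_singleton_self a)
    have har : s.erase a = r := by
      rw [← Finset.sdiff_singleton_eq_erase, ← ha, Finset.sdiff_sdiff_eq_self h.1]
    rw [Finset.sum_eq_single_of_mem a has.1]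
    · rw [har, Finsupp.single_eq_same]
    · intro b hb hba
      refine Finsupp.single_eq_of_ne fun hbr => hba ?_
      have : b ∉ r := by rw [hbr]; exact Finset.notMem_erase b s
      have : b ∈ s \ r := Finset.mem_sdiff.2 ⟨hb, this⟩
      rw [ha] at this
      exact Finset.mem_singleton.1 this
  · refine Finset.sum_eq_zero fun b hb => Finsupp.single_eq_of_ne fun hbr => h ?_
    rw [hbr]
    exact ⟨Finset.erase_subset _ _, Finset.card_erase_add_one hb⟩

theorem simplexBoundary_apply_ne_zero {s r : Finset Plane} (h : simplexBoundary s r ≠ 0) :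
    r ⊆ s ∧ r.card + 1 = s.card ∧ 2 ≤ s.card := by
  by_cases hs : 2 ≤ s.card
  · rw [simplexBoundary_apply hs] at h
    split_ifs at h with h'
    · exact ⟨h'.1, h'.2, hs⟩
    · exact absurd rfl h
  · rw [simplexBoundary_of_card_le_one (by omega)] at h
    exact absurd rfl h

theorem boundaryMap_apply (c : Chain) (r : Finset Plane) :
    boundaryMap c r = ∑ t ∈ c.support, c t * simplexBoundary t r := by
  rw [boundaryMap_eq_sum, Finsupp.finsetSum_apply]
  rfl

theorem exists_coface_of_boundaryMap_apply_ne_zero {c : Chain} {r : Finset Plane}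
    (h : boundaryMap c r ≠ 0) : ∃ t, c t ≠ 0 ∧ r ⊆ t ∧ r.card + 1 = t.card ∧ 2 ≤ t.card := by
  rw [boundaryMap_apply] at h
  obtain ⟨t, ht, h⟩ := Finset.exists_ne_zero_of_sum_ne_zero h
  exact ⟨t, Finsupp.mem_support_iff.1 ht, simplexBoundary_apply_ne_zero (right_ne_zero_of_mul h)⟩

theorem boundaryMap_mem_chains {L L' : Set (Finset Plane)} {k : ℕ} {c : Chain}
    (hc : c ∈ chains L (k + 1))
    (h : ∀ s ∈ L, s.card = k + 1 → ∀ r ⊆ s, r.Nonempty → r ∈ L') : boundaryMap c ∈ chains L' k := by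
  refine mem_chains.2 fun r hr => ?_
  obtain ⟨t, ht, hrt, hcard, h2⟩ := exists_coface_of_boundaryMap_apply_ne_zero hr
  obtain ⟨htL, htk⟩ := mem_chains.1 hc t ht
  exact ⟨h t htL htk r hrt (Finset.card_pos.1 (by omega)), by omega⟩

theorem boundaryMap_eq_zero_of_chains_one {L : Set (Finset Plane)} {c : Chain}
    (hc : c ∈ chains L 1) : boundaryMap c = 0 := by
  rw [boundaryMap_eq_sum]
  refine Finset.sum_eq_zero fun t ht => ?_
  rw [simplexBoundary_of_card_le_one ((mem_chains.1 hc t (Finsupp.mem_support_iff.1 ht)).2.le),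
    smul_zero]

theorem boundaryMap_boundaryMap_of_chains_three {L : Set (Finset Plane)} {c : Chain}
    (hc : c ∈ chains L 3) : boundaryMap (boundaryMap c) = 0 := by
  rw [boundaryMap_eq_sum c, map_sum]
  refine Finset.sum_eq_zero fun t ht => ?_
  obtain ⟨u, v, w, huv, huw, hvw, rfl⟩ :=
    Finset.card_eq_three.1 (mem_chains.1 hc t (Finsupp.mem_support_iff.1 ht)).2
  rw [map_smul, simplexBoundary_triple huv huw hvw]
  simp only [map_add, boundaryMap_single, simplexBoundary_pair huv, simplexBoundary_pair huw,
    simplexBoundary_pair hvw]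
  set a : Chain := Finsupp.single {u} 1
  set b : Chain := Finsupp.single {v} 1
  set d : Chain := Finsupp.single {w} 1
  have : b + d + (a + d) + (a + b) = (a + a) + (b + b) + (d + d) := by abel
  rw [this]
  simp only [ZModModule.add_self, smul_zero]

/-- If the edges of a chain join related vertices, its boundary cannot be a pair of unrelated
vertices. -/
theorem rel_of_boundaryMap_eq {r : Plane → Plane → Prop} (hr : Equivalence r) {L : Set (Finset Plane)}
    {d : Chain} (hd : d ∈ chains L 2) (h : ∀ s ∈ L, ∀ x y, s = {x, y} → x ≠ y → r x y) {u v : Plane}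
    (huv : boundaryMap d = Finsupp.single {u} 1 + Finsupp.single {v} 1) : r u v := by
  classical
  -- `φ` counts modulo 2 the vertices in the class of `u`. The ends of each edge are in the same
  -- class, so `φ` kills boundaries.
  let φ : Chain →ₗ[ZMod 2] ZMod 2 :=
    Finsupp.linearCombination (ZMod 2) fun s => if ∃ x, s = {x} ∧ r u x then 1 else 0
  have hφ : ∀ x, φ (Finsupp.single {x} 1) = if r u x then 1 else 0 := fun x => by
    simp only [φ, Finsupp.linearCombination_single, one_smul, Finset.singleton_inj]
    congr 1
    simp
  have h0 : φ (boundaryMap d) = 0 := by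
    rw [boundaryMap_eq_sum, map_sum]
    refine Finset.sum_eq_zero fun t ht => ?_
    obtain ⟨htL, htc⟩ := mem_chains.1 hd t (Finsupp.mem_support_iff.1 ht)
    obtain ⟨x, y, hxy, rfl⟩ := Finset.card_eq_two.1 htc
    have hrxy := h _ htL x y rfl hxy
    have : r u x ↔ r u y := ⟨fun h => hr.trans h hrxy, fun h => hr.trans h (hr.symm hrxy)⟩
    rw [map_smul, simplexBoundary_pair hxy, map_add, hφ, hφ]
    simp only [this]
    rw [CharTwo.add_self_eq_zero, smul_zero]
  rw [huv, map_add, hφ, hφ, if_pos (hr.refl u)] at h0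
  by_contra hv
  rw [if_neg hv] at h0
  exact absurd h0 (by decide)

/-- A colouring of closed sets that agrees on sets that meet in `S` is constant on the sets that
meet the preconnected set `S`. -/
theorem IsPreconnected.color_eq {L : Set (Finset Plane)} (hL : L.Finite) {S : Set Plane}
    (hS : IsPreconnected S) (hcover : S ⊆ spaceOf L) {c : Finset Plane → Prop}
    (h : ∀ s ∈ L, ∀ t ∈ L, ∀ x ∈ S, x ∈ convexHull ℝ (s : Set Plane) →
      x ∈ convexHull ℝ (t : Set Plane) → c s → c t)
    {s t : Finset Plane} (hs : s ∈ L) (ht : t ∈ L) {x y : Plane} (hx : x ∈ S)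
    (hxs : x ∈ convexHull ℝ (s : Set Plane)) (hy : y ∈ S) (hyt : y ∈ convexHull ℝ (t : Set Plane))
    (hcs : c s) : c t := by
  by_contra hct
  have hA := isClosed_spaceOf (hL.subset (Set.sep_subset L c))
  have hB := isClosed_spaceOf (hL.subset (Set.sep_subset L fun s => ¬ c s))
  obtain ⟨z, hzS, hzA, hzB⟩ := isPreconnected_closed_iff.1 hS _ _ hA hB
    (fun z hz => by
      obtain ⟨r, hr, hzr⟩ := mem_spaceOf.1 (hcover hz)
      by_cases hcr : c r
      · exact Or.inl (mem_spaceOf.2 ⟨r, ⟨hr, hcr⟩, hzr⟩)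
      · exact Or.inr (mem_spaceOf.2 ⟨r, ⟨hr, hcr⟩, hzr⟩))
    ⟨x, hx, mem_spaceOf.2 ⟨s, ⟨hs, hcs⟩, hxs⟩⟩ ⟨y, hy, mem_spaceOf.2 ⟨t, ⟨ht, hct⟩, hyt⟩⟩
  obtain ⟨r, hr, hzr⟩ := mem_spaceOf.1 hzA
  obtain ⟨r', hr', hzr'⟩ := mem_spaceOf.1 hzB
  exact hr'.2 (h r hr.1 r' hr'.1 z hzS hzr hzr' hr.2)

/-! ### Persistence pairs -/

namespace LowerStarFiltration

variable {K : Geometry.SimplicialComplex ℝ Plane} {f : Plane → ℝ} (S : LowerStarFiltration K f)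

theorem before_subset_upTo (s : Finset Plane) : S.before s ⊆ S.upTo s := fun _ h => ⟨h.1, h.2.le⟩

theorem mem_upTo_iff {s : Finset Plane} (hs : s ∈ K.faces) {r : Finset Plane} :
    r ∈ S.upTo s ↔ r = s ∨ r ∈ S.before s := by
  constructor
  · rintro ⟨h1, h2⟩
    rcases h2.eq_or_lt with h | h
    · exact Or.inl (S.pos_injOn h1 hs h)
    · exact Or.inr ⟨h1, h⟩
  · rintro (rfl | h)
    · exact ⟨hs, le_rfl⟩
    · exact S.before_subset_upTo s h

/-- The last simplex of a nonzero chain. -/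
theorem exists_last {c : Chain} (hc : c ≠ 0) : ∃ s, c s ≠ 0 ∧ ∀ r, c r ≠ 0 → S.pos r ≤ S.pos s := by
  obtain ⟨s, hs, h⟩ := Finset.exists_max_image c.support S.pos
    (Finsupp.support_nonempty_iff.2 hc)
  exact ⟨s, Finsupp.mem_support_iff.1 hs, fun r hr => h r (Finsupp.mem_support_iff.2 hr)⟩

theorem mem_chains_before {t : Finset Plane} (ht : t ∈ K.faces) {k : ℕ} {c : Chain}
    (hc : c ∈ chains (S.upTo t) k) (h : c t = 0) : c ∈ chains (S.before t) k := by
  refine mem_chains.2 fun s hs => ?_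
  obtain ⟨h1, h2⟩ := mem_chains.1 hc s hs
  rcases (S.mem_upTo_iff ht).1 h1 with rfl | h1
  · exact absurd h hs
  · exact ⟨h1, h2⟩

theorem sub_single_mem_chains_before {t : Finset Plane} (ht : t ∈ K.faces) {k : ℕ} {c : Chain}
    (hc : c ∈ chains (S.upTo t) k) (h : c t ≠ 0) :
    c - Finsupp.single t 1 ∈ chains (S.before t) k := by
  refine S.mem_chains_before ht (Submodule.sub_mem _ hc ?_) ?_
  · exact single_mem_chains ((S.mem_upTo_iff ht).2 (Or.inl rfl)) (mem_chains.1 hc t h).2 _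
  · rw [Finsupp.sub_apply, Finsupp.single_eq_same, ZMod.eq_one_of_ne_zero_two h, sub_self]

variable {S}

/-- The simplex that destroys a class is not itself part of a new cycle. -/
theorem IsPair.card_eq_and_notMem {s t : Finset Plane} (h : S.IsPair s t) :
    t.card = s.card + 1 ∧ simplexBoundary t ∉ boundaries (S.before t) s.card := by
  obtain ⟨hs, ht, hpos, z, hz, hz1, z', hz', hzz⟩ := h
  obtain ⟨d, hd, hdz⟩ := mem_boundaries.1 hzz
  by_cases hdt : d t = 0
  · exact absurd (mem_boundaries.2 ⟨d, S.mem_chains_before ht hd hdt, hdz⟩) (hz1 z' hz')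
  -- If the boundary of `t` already bounded before `t`, it could replace `t` in `d`, and `z - z'`
  -- would bound too early.
  refine ⟨(mem_chains.1 hd t hdt).2, fun hneg => hz1 z' hz' ?_⟩
  have h1 := mem_boundaries.2 ⟨_, S.sub_single_mem_chains_before ht hd hdt, rfl⟩
  rw [map_sub, boundaryMap_single, hdz] at h1
  simpa using Submodule.add_mem _ h1 hneg

variable (S)

/-- An edge that joins two components destroys the younger one. -/
theorem exists_isPair_of_notMem_boundaries {e : Finset Plane} (he : e ∈ K.faces) (hcard : e.card = 2)
    (hneg : simplexBoundary e ∉ boundaries (S.before e) 1) : ∃ w, S.IsPair {w} e := by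
  classical
  -- The elder rule: among the chains that differ from the boundary of `e` by an earlier boundary,
  -- take one whose last vertex comes as early as possible. That vertex is the partner of `e`.
  let P : ℕ → Prop := fun n => ∃ b ∈ boundaries (S.before e) 1,
    ∀ s, (simplexBoundary e + b) s ≠ 0 → S.pos s ≤ n
  have hne : ∀ b ∈ boundaries (S.before e) 1, simplexBoundary e + b ≠ 0 := fun b hb h =>
    hneg (by rw [← ZModModule.sub_eq_add, sub_eq_zero] at h; rwa [h])
  have hex : ∃ n, P n := by
    obtain ⟨s, -, hs⟩ := S.exists_last (hne 0 (Submodule.zero_mem _))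
    exact ⟨S.pos s, 0, Submodule.zero_mem _, hs⟩
  obtain ⟨b, hb, hmax⟩ := Nat.find_spec hex
  set n := Nat.find hex
  obtain ⟨s, hs0, hs⟩ := S.exists_last (hne b hb)
  have hup : S.before e ⊆ S.upTo e := S.before_subset_upTo e
  have heup : e ∈ S.upTo e := ⟨he, le_rfl⟩
  have hbz : simplexBoundary e + b ∈ boundaries (S.upTo e) 1 := by
    refine Submodule.add_mem _ (mem_boundaries.2 ⟨_, single_mem_chains heup hcard 1,
      boundaryMap_single e⟩) (boundaries_mono hup _ hb)
  obtain ⟨d, hd, hdz⟩ := mem_boundaries.1 hbz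
  have hzchain : simplexBoundary e + b ∈ chains K.faces 1 := by
    rw [← hdz]
    exact boundaryMap_mem_chains hd fun s hs _ r hr hr0 => K.down_closed hs.1 hr hr0
  obtain ⟨hsK, hscard⟩ := mem_chains.1 hzchain s hs0
  have hse : S.pos s < S.pos e := by
    rw [← hdz] at hs0
    obtain ⟨t, ht, hst, hc, -⟩ := exists_coface_of_boundaryMap_apply_ne_zero hs0
    have htup := (mem_chains.1 hd t ht).1
    refine lt_of_lt_of_le (S.pos_face s hsK t htup.1 ?_) htup.2
    exact Finset.ssubset_iff_subset_ne.2 ⟨hst, fun h => by subst h; omega⟩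
  obtain ⟨w, rfl⟩ := Finset.card_eq_one.1 hscard
  have hzup : simplexBoundary e + b ∈ chains (S.upTo {w}) 1 := mem_chains.2 fun r hr =>
    ⟨⟨(mem_chains.1 hzchain r hr).1, hs r hr⟩, (mem_chains.1 hzchain r hr).2⟩
  refine ⟨w, hsK, he, hse, simplexBoundary e + b, ?_, ?_, 0, Submodule.zero_mem _, ?_⟩
  · rw [hscard]
    exact ⟨hzup, boundaryMap_eq_zero_of_chains_one hzup⟩
  · intro z' hz' hmem
    rw [hscard] at hmem hz'
    -- If `z - z'` bounded before `e`, then `z'` would be such a representative with an earlier last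
    -- vertex, against minimality.
    have hb' : b - (simplexBoundary e + b - z') ∈ boundaries (S.before e) 1 :=
      Submodule.sub_mem _ hb hmem
    have hz'eq : simplexBoundary e + (b - (simplexBoundary e + b - z')) = z' := by abel
    obtain ⟨r, hr0, hr⟩ := S.exists_last (hne _ hb')
    have hlt : S.pos r < n := by
      have h1 : S.pos r < S.pos {w} := by
        rw [hz'eq] at hr0
        exact (mem_chains.1 hz'.1 r hr0).1.2
      exact h1.trans_le (hmax _ hs0)
    exact Nat.find_min hex hlt ⟨_, hb', hr⟩
  · rw [hscard, sub_zero]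
    exact hbz

/-- A simplex that creates a class which dies no later than at `r` is paired with a simplex no later
than `r`. -/
theorem exists_isPair_of_mem_boundaries {e r : Finset Plane} (he : e ∈ K.faces) {z : Chain}
    (hz : z ∈ cycles (S.upTo e) e.card) (hze : z e ≠ 0)
    (hr : z ∈ boundaries (S.upTo r) e.card) : ∃ t, S.IsPair e t ∧ S.pos t ≤ S.pos r := by
  classical
  -- The partner of `e` is the last simplex of a filling of `z - z'`, where the older cycle `z'` and
  -- the filling are chosen so that it ends as early as possible.
  let P : ℕ → Prop := fun n => ∃ z' ∈ cycles (S.before e) e.card,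
    ∃ d ∈ chains K.faces (e.card + 1), (∀ s, d s ≠ 0 → S.pos s ≤ n) ∧ boundaryMap d = z - z'
  have hP : P (S.pos r) := by
    obtain ⟨d, hd, hdz⟩ := mem_boundaries.1 hr
    exact ⟨0, Submodule.zero_mem _, d, chains_mono (fun s hs => hs.1) _ hd,
      fun s hs => (mem_chains.1 hd s hs).1.2, by rw [hdz, sub_zero]⟩
  have hex : ∃ n, P n := ⟨_, hP⟩
  have hfind : Nat.find hex ≤ S.pos r := Nat.find_le hP
  obtain ⟨z', hz', d, hd, hdn, hdz⟩ := Nat.find_spec hex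
  -- An older cycle cannot cancel `e`, so the filling is nonzero and contains a coface of `e`.
  have hz'e : ∀ y ∈ cycles (S.before e) e.card, (z - y) e ≠ 0 := by
    intro y hy h
    rw [Finsupp.sub_apply, sub_eq_zero] at h
    exact absurd (mem_chains.1 hy.1 e (h ▸ hze)).1.2 (lt_irrefl _)
  have hd0 : d ≠ 0 := by
    rintro rfl
    refine hz'e z' hz' ?_
    rw [← hdz]
    simp
  obtain ⟨t, ht0, ht⟩ := S.exists_last hd0
  have htK := (mem_chains.1 hd t ht0).1
  have htn : S.pos t = Nat.find hex :=
    le_antisymm (hdn t ht0) (Nat.find_le ⟨z', hz', d, hd, ht, hdz⟩)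
  refine ⟨t, ⟨he, htK, ?_, z, hz, ?_, z', hz', ?_⟩, htn ▸ hfind⟩
  · obtain ⟨q, hq0, hq, hqc, -⟩ := exists_coface_of_boundaryMap_apply_ne_zero (hdz ▸ hz'e z' hz')
    refine (S.pos_face e he q (mem_chains.1 hd q hq0).1 ?_).trans_le (ht q hq0)
    exact Finset.ssubset_iff_subset_ne.2 ⟨hq, fun h => by subst h; omega⟩
  · intro y hy hmem
    obtain ⟨d', hd', hdz'⟩ := mem_boundaries.1 hmem
    have hd0' : d' ≠ 0 := by
      rintro rfl
      refine hz'e y hy ?_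
      rw [← hdz']
      simp
    obtain ⟨q, hq0, hq⟩ := S.exists_last hd0'
    have hlt : S.pos q < Nat.find hex := htn ▸ (mem_chains.1 hd' q hq0).1.2
    exact Nat.find_min hex hlt ⟨y, hy, d', chains_mono (fun s hs => hs.1) _ hd', hq, hdz'⟩
  · exact mem_boundaries.2 ⟨d, mem_chains.2 fun s hs =>
      ⟨⟨(mem_chains.1 hd s hs).1, ht s hs⟩, (mem_chains.1 hd s hs).2⟩, hdz⟩

end LowerStarFiltration

/-! ### Planar complexes -/

/-- A linear functional that separates the points of a finite set. -/
theorem exists_injOn_functional {V : Set Plane} (hV : V.Finite) :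
    ∃ r : ℝ, Set.InjOn (fun x : Plane => x 0 + r * x 1) V := by
  -- Each pair of points with different second coordinates excludes a single value of `r`.
  obtain ⟨r, hr⟩ := ((hV.prod hV).image
    fun p : Plane × Plane => -(p.1 0 - p.2 0) / (p.1 1 - p.2 1)).exists_notMem
  refine ⟨r, fun u hu v hv h => ?_⟩
  by_contra huv
  simp only at h
  by_cases h1 : u 1 = v 1
  · refine huv (PiLp.ext fun i => ?_)
    fin_cases i
    · simp only [Fin.zero_eta]; rw [h1] at h; linarith
    · exact h1
  · refine hr ⟨(u, v), ⟨hu, hv⟩, ?_⟩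
    have : u 1 - v 1 ≠ 0 := sub_ne_zero.2 h1
    simp only
    field_simp
    linarith

/-- Twice the signed area of the triangle `u v x`. -/
def cross (u v x : Plane) : ℝ := (v 0 - u 0) * (x 1 - u 1) - (v 1 - u 1) * (x 0 - u 0)

theorem affineMap_plane_apply (l : Plane →ᵃ[ℝ] ℝ) : ∃ p q c : ℝ, ∀ x, l x = p * x 0 + q * x 1 + c := by
  refine ⟨l.linear (EuclideanSpace.single 0 1), l.linear (EuclideanSpace.single 1 1), l 0,
    fun x => ?_⟩
  have h1 : l x = l.linear x + l 0 := by simpa using l.map_vadd 0 x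
  have h2 : x = x 0 • EuclideanSpace.single 0 1 + x 1 • EuclideanSpace.single 1 1 := by
    refine PiLp.ext fun i => ?_
    fin_cases i <;> simp
  rw [h1]
  conv_lhs => rw [h2]
  rw [map_add, map_smul, map_smul, smul_eq_mul, smul_eq_mul]
  ring

/-- The barycentric coordinate of `a` is affine, 0 at `u` and `v` and 1 at `a`, so `a` cannot lie on
the line through `u` and `v`. -/
theorem cross_ne_zero {K : Geometry.SimplicialComplex ℝ Plane} {u v a : Plane}
    (huv : u ≠ v) (hua : u ≠ a) (hva : v ≠ a) (h : {u, v, a} ∈ K.faces) : cross u v a ≠ 0 := by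
  intro h0
  obtain ⟨l, -, hl⟩ := (K.indep h).exists_coord
  obtain ⟨p, q, c, hpq⟩ := affineMap_plane_apply (l a)
  have hu := hl a (by simp) u (by simp)
  have hv := hl a (by simp) v (by simp)
  have ha := hl a (by simp) a (by simp)
  rw [if_neg hua, hpq] at hu
  rw [if_neg hva, hpq] at hv
  rw [if_pos rfl, hpq] at ha
  unfold cross at h0
  have h1 : v 0 - u 0 = 0 := by
    linear_combination (-(v 0 - u 0)) * (ha - hu) + q * h0 + (a 0 - u 0) * (hv - hu)
  have h2 : v 1 - u 1 = 0 := by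
    linear_combination (-(v 1 - u 1)) * (ha - hu) - p * h0 + (a 1 - u 1) * (hv - hu)
  refine huv (PiLp.ext fun i => ?_)
  fin_cases i
  · exact (sub_eq_zero.1 h1).symm
  · exact (sub_eq_zero.1 h2).symm

theorem mem_convexHull_triple {u v a : Plane} {α β γ : ℝ} (hα : 0 ≤ α) (hβ : 0 ≤ β) (hγ : 0 ≤ γ)
    (h : α + β + γ = 1) :
    α • u + β • v + γ • a ∈ convexHull ℝ (({u, v, a} : Finset Plane) : Set Plane) := by
  have hc := convex_convexHull ℝ (({u, v, a} : Finset Plane) : Set Plane)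
  have hs := subset_convexHull ℝ (({u, v, a} : Finset Plane) : Set Plane)
  have := hc.sum_mem (t := Finset.univ) (w := ![α, β, γ]) (z := ![u, v, a])
    (by intro i _; fin_cases i <;> simpa) (by simp [Fin.sum_univ_three, h])
    (by intro i _; fin_cases i <;> exact hs (by simp))
  simpa [Fin.sum_univ_three] using this

/-- Two triangles on the same side of a common edge overlap just above its midpoint, whereas in a
complex two distinct ones meet only along that edge. -/
theorem eq_of_cross_pos {K : Geometry.SimplicialComplex ℝ Plane} {u v a b : Plane}
    (ha : {u, v, a} ∈ K.faces) (hb : {u, v, b} ∈ K.faces)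
    (hA : 0 < cross u v a) (hB : 0 < cross u v b) : a = b := by
  by_contra hab
  set A := cross u v a with hAdef
  set B := cross u v b with hBdef
  have hD : 0 < (v 0 - u 0) ^ 2 + (v 1 - u 1) ^ 2 := by
    by_contra h
    have h0 : v 0 - u 0 = 0 := by nlinarith [sq_nonneg (v 0 - u 0), sq_nonneg (v 1 - u 1)]
    have h1 : v 1 - u 1 = 0 := by nlinarith [sq_nonneg (v 0 - u 0), sq_nonneg (v 1 - u 1)]
    rw [hAdef, cross, h0, h1] at hA
    simp at hA
  set D := (v 0 - u 0) ^ 2 + (v 1 - u 1) ^ 2 with hDdef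
  -- The vector `B • (a - u) - A • (b - u)` has zero cross product with `v - u`, hence equals `κ •
  -- (v - u)`; the scalar is read off by projection.
  set κ : ℝ := ((B * (a 0 - u 0) - A * (b 0 - u 0)) * (v 0 - u 0) +
    (B * (a 1 - u 1) - A * (b 1 - u 1)) * (v 1 - u 1)) / D with hκ
  have hκD : κ * D = (B * (a 0 - u 0) - A * (b 0 - u 0)) * (v 0 - u 0) +
    (B * (a 1 - u 1) - A * (b 1 - u 1)) * (v 1 - u 1) := by
    rw [hκ]; field_simp
  have hx0 : B * (a 0 - u 0) - A * (b 0 - u 0) = κ * (v 0 - u 0) := by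
    have : (B * (a 0 - u 0) - A * (b 0 - u 0)) * D = κ * (v 0 - u 0) * D := by
      rw [mul_right_comm, hκD, hDdef, hAdef, hBdef, cross, cross]
      ring
    exact mul_right_cancel₀ hD.ne' this
  have hx1 : B * (a 1 - u 1) - A * (b 1 - u 1) = κ * (v 1 - u 1) := by
    have : (B * (a 1 - u 1) - A * (b 1 - u 1)) * D = κ * (v 1 - u 1) * D := by
      rw [mul_right_comm, hκD, hDdef, hAdef, hBdef, cross, cross]
      ring
    exact mul_right_cancel₀ hD.ne' this
  -- Small enough that `ε * A`, `ε * B` and `|ε * κ|` add up to less than 1/4, so that all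
  -- coefficients below are nonnegative.
  set ε : ℝ := 1 / (4 * (1 + A + B + |κ|)) with hε
  have hden : 0 < 1 + A + B + |κ| := by positivity
  have hε0 : 0 < ε := by positivity
  have hεd : ε * (1 + A + B + |κ|) = 1 / 4 := by rw [hε]; field_simp
  have hεA : 0 < ε * A := by positivity
  have hεB : 0 < ε * B := by positivity
  have hεκ : |ε * κ| = ε * |κ| := by rw [abs_mul, abs_of_pos hε0]
  have hεκ0 : 0 ≤ ε * |κ| := by positivity
  have hκ1 := (abs_le.1 hεκ.le).1
  have hκ2 := (abs_le.1 hεκ.le).2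
  set x : Plane := (1 / 2 - ε * B) • u + (1 / 2 : ℝ) • v + (ε * B) • a with hx
  have hx' : x = (1 / 2 - ε * κ - ε * A) • u + (1 / 2 + ε * κ) • v + (ε * A) • b := by
    refine PiLp.ext fun i => ?_
    fin_cases i
    · simp only [hx, Fin.zero_eta, PiLp.add_apply, PiLp.smul_apply, smul_eq_mul]
      linear_combination ε * hx0
    · simp only [hx, Fin.mk_one, PiLp.add_apply, PiLp.smul_apply, smul_eq_mul]
      linear_combination ε * hx1
  have h1 : x ∈ convexHull ℝ (({u, v, a} : Finset Plane) : Set Plane) :=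
    mem_convexHull_triple (by linarith) (by linarith) (by linarith) (by ring)
  have h2 : x ∈ convexHull ℝ (({u, v, b} : Finset Plane) : Set Plane) := by
    rw [hx']
    exact mem_convexHull_triple (by linarith) (by linarith) (by linarith) (by ring)
  have h3 := K.inter_subset_convexHull ha hb ⟨h1, h2⟩
  have h4 : x ∈ convexHull ℝ {u, v} := by
    refine convexHull_mono ?_ h3
    rintro y ⟨hy1, hy2⟩
    simp only [Finset.coe_insert, Finset.coe_singleton, Set.mem_insert_iff,
      Set.mem_singleton_iff] at hy1 hy2 ⊢
    grind
  rw [convexHull_pair, segment_eq_image'] at h4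
  obtain ⟨t, -, ht⟩ := h4
  have h5 : cross u v x = 0 := by
    rw [← ht]
    simp only [cross, PiLp.add_apply, PiLp.smul_apply, PiLp.sub_apply, smul_eq_mul]
    ring
  have h6 : cross u v x = ε * B * A := by
    rw [hAdef, hx]
    simp only [cross, PiLp.add_apply, PiLp.smul_apply, smul_eq_mul]
    ring
  have : 0 < ε * B * A := by positivity
  linarith

theorem cross_swap (u v x : Plane) : cross v u x = -cross u v x := by
  simp only [cross]; ring

theorem eq_of_cross_mul_pos {K : Geometry.SimplicialComplex ℝ Plane} {u v a b : Plane}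
    (ha : {u, v, a} ∈ K.faces) (hb : {u, v, b} ∈ K.faces)
    (h : 0 < cross u v a * cross u v b) : a = b := by
  rcases mul_pos_iff.1 h with ⟨h1, h2⟩ | ⟨h1, h2⟩
  · exact eq_of_cross_pos ha hb h1 h2
  · rw [Finset.insert_comm] at ha hb
    exact eq_of_cross_pos ha hb (by rw [cross_swap]; linarith)
      (by rw [cross_swap]; linarith)

theorem exists_eq_insert_pair {u v : Plane} {t : Finset Plane} (huv : u ≠ v) (h : {u, v} ⊆ t)
    (ht : t.card = 3) : ∃ a, t = {u, v, a} ∧ u ≠ a ∧ v ≠ a := by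
  obtain ⟨a, ha⟩ := Finset.card_eq_one.1 (show (t \ {u, v}).card = 1 by
    rw [Finset.card_sdiff_of_subset h, ht, Finset.card_pair huv])
  have hat := Finset.mem_sdiff.1 (ha ▸ Finset.mem_singleton_self a)
  refine ⟨a, ?_, fun h => hat.2 (by simp [h]), fun h => hat.2 (by simp [h])⟩
  rw [← Finset.sdiff_union_of_subset h, ha]
  ext x
  simp only [Finset.mem_union, Finset.mem_insert, Finset.mem_singleton]
  grind

/-- Among three triangles on an edge two are equal. -/
theorem eq_or_eq_or_eq_of_triangles {K : Geometry.SimplicialComplex ℝ Plane}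
    {e t₁ t₂ t₃ : Finset Plane} (he : e.card = 2) (h₁ : t₁ ∈ K.faces) (h₂ : t₂ ∈ K.faces)
    (h₃ : t₃ ∈ K.faces) (c₁ : t₁.card = 3) (c₂ : t₂.card = 3) (c₃ : t₃.card = 3)
    (e₁ : e ⊆ t₁) (e₂ : e ⊆ t₂) (e₃ : e ⊆ t₃) : t₁ = t₂ ∨ t₁ = t₃ ∨ t₂ = t₃ := by
  obtain ⟨u, v, huv, rfl⟩ := Finset.card_eq_two.1 he
  obtain ⟨a, rfl, hua, hva⟩ := exists_eq_insert_pair huv e₁ c₁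
  obtain ⟨b, rfl, hub, hvb⟩ := exists_eq_insert_pair huv e₂ c₂
  obtain ⟨c, rfl, huc, hvc⟩ := exists_eq_insert_pair huv e₃ c₃
  have ha := cross_ne_zero huv hua hva h₁
  have hb := cross_ne_zero huv hub hvb h₂
  have hc := cross_ne_zero huv huc hvc h₃
  have h : 0 < cross u v a * cross u v b ∨ 0 < cross u v a * cross u v c ∨
      0 < cross u v b * cross u v c := by
    rcases ha.lt_or_gt with ha | ha <;> rcases hb.lt_or_gt with hb | hb <;>
      rcases hc.lt_or_gt with hc | hc <;> simp [mul_pos_iff, ha, hb, hc]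
  rcases h with h | h | h
  · exact Or.inl (by rw [eq_of_cross_mul_pos h₁ h₂ h])
  · exact Or.inr (Or.inl (by rw [eq_of_cross_mul_pos h₁ h₃ h]))
  · exact Or.inr (Or.inr (by rw [eq_of_cross_mul_pos h₂ h₃ h]))

/-- Modulo 2, a single coface in the chain could not cancel at `e`. -/
theorem exists_ne_coface {c : Chain} {e t : Finset Plane} (h0 : boundaryMap c e = 0) (ht : c t ≠ 0)
    (het : e ⊆ t) (hcard : e.card + 1 = t.card) (h2 : 2 ≤ t.card) :
    ∃ t', t' ≠ t ∧ c t' ≠ 0 ∧ e ⊆ t' := by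
  by_contra! h
  rw [boundaryMap_apply, Finset.sum_eq_single_of_mem t (Finsupp.mem_support_iff.2 ht),
    simplexBoundary_apply h2, if_pos ⟨het, hcard⟩, mul_one] at h0
  · exact ht h0
  · intro t' ht' hne
    by_contra hz
    exact h t' hne (Finsupp.mem_support_iff.1 ht')
      (simplexBoundary_apply_ne_zero (right_ne_zero_of_mul hz)).1

/-- A planar complex has no nonzero two-dimensional cycle. -/
theorem eq_zero_of_boundaryMap_eq_zero {K : Geometry.SimplicialComplex ℝ Plane} {c : Chain}
    (hc : c ∈ chains K.faces 3) (h0 : boundaryMap c = 0) : c = 0 := by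
  classical
  by_contra hne
  set V : Finset Plane := c.support.biUnion id with hV
  have hmemV : ∀ t, c t ≠ 0 → ∀ x ∈ t, x ∈ V := fun t ht x hx =>
    Finset.mem_biUnion.2 ⟨t, Finsupp.mem_support_iff.2 ht, hx⟩
  obtain ⟨r, hr⟩ := exists_injOn_functional V.finite_toSet
  set h : Plane → ℝ := fun x => x 0 + r * x 1 with hh
  obtain ⟨t₀, ht₀⟩ := Finsupp.support_nonempty_iff.2 hne
  have ht₀' := Finsupp.mem_support_iff.1 ht₀
  have hVne : V.Nonempty := by
    obtain ⟨x, hx⟩ := K.nonempty_of_mem_faces (mem_chains.1 hc t₀ ht₀').1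
    exact ⟨x, hmemV t₀ ht₀' x hx⟩
  obtain ⟨v, hvV, hvmax⟩ := Finset.exists_max_image V h hVne
  obtain ⟨t₁, ht₁, hvt₁⟩ := Finset.mem_biUnion.1 hvV
  have ht₁' := Finsupp.mem_support_iff.1 ht₁
  have hlt : ∀ x ∈ V, x ≠ v → 0 < h v - h x := fun x hx hxv =>
    sub_pos.2 (lt_of_le_of_ne (hvmax x hx) fun he => hxv (hr hx hvV he))
  set A : Finset Plane := V.filter fun x => x ≠ v ∧ ∃ t, c t ≠ 0 ∧ v ∈ t ∧ x ∈ t with hA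
  have hAne : A.Nonempty := by
    obtain ⟨x, hx, hxv⟩ := Finset.exists_mem_ne
      (by rw [(mem_chains.1 hc t₁ ht₁').2]; omega : 1 < t₁.card) v
    exact ⟨x, Finset.mem_filter.2 ⟨hmemV t₁ ht₁' x hx, hxv, t₁, ht₁', hvt₁, hx⟩⟩
  -- Below the highest vertex `v`, this quotient orders the edges at `v` by angle. The edge to `a`
  -- is extremal, so all triangles of `c` on it lie on one side, although two are needed for
  -- cancellation.
  obtain ⟨a, haA, hamax⟩ := Finset.exists_max_image A (fun x => (x 1 - v 1) / (h v - h x)) hAne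
  obtain ⟨haV, hav, t, ht, hvt, hat⟩ := Finset.mem_filter.1 haA
  have hsub : {v, a} ⊆ t := by
    intro x hx
    rcases Finset.mem_insert.1 hx with rfl | hx
    · exact hvt
    · rwa [Finset.mem_singleton.1 hx]
  obtain ⟨htK, htc⟩ := mem_chains.1 hc t ht
  have h0e : boundaryMap c {v, a} = 0 := by rw [h0]; rfl
  obtain ⟨t', htt', ht', hsub'⟩ := exists_ne_coface h0e ht hsub
    (by rw [Finset.card_pair hav.symm, htc]) (by omega)
  obtain ⟨htK', htc'⟩ := mem_chains.1 hc t' ht'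
  obtain ⟨b, rfl, hvb, hab⟩ := exists_eq_insert_pair hav.symm hsub htc
  obtain ⟨b', rfl, hvb', hab'⟩ := exists_eq_insert_pair hav.symm hsub' htc'
  have key : ∀ b : Plane, {v, a, b} ∈ K.faces → c {v, a, b} ≠ 0 → v ≠ b → a ≠ b →
      0 < cross v a b := by
    intro b hbK hb0 hvb hab
    have hbV : b ∈ V := hmemV _ hb0 b (by simp)
    have h1 := hamax b (Finset.mem_filter.2 ⟨hbV, hvb.symm, _, hb0, by simp, by simp⟩)
    have h2 := hlt a haV hav
    have h3 := hlt b hbV hvb.symm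
    rw [div_le_div_iff₀ h3 h2] at h1
    refine lt_of_le_of_ne ?_ (cross_ne_zero hav.symm hvb hab hbK).symm
    simp only [cross, hh] at h1 ⊢
    nlinarith
  refine htt' ?_
  rw [eq_of_cross_pos htK htK' (key b htK ht hvb hab) (key b' htK' ht' hvb' hab')]

/-- A set of simplices of a planar complex that contains triangles has an edge that lies in exactly
one of them, and this edge can be taken outside any set in which no cycle bounds. -/
theorem exists_free_edge {K : Geometry.SimplicialComplex ℝ Plane} {L Γ : Set (Finset Plane)}
    (hL : L.Finite) (hLK : L ⊆ K.faces) {t : Finset Plane} (ht : t ∈ L) (htc : t.card = 3)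
    (hdown : ∀ s ∈ L, ∀ r ⊆ s, r.Nonempty → r ∈ L)
    (hΓ : ∀ z ∈ cycles Γ 2, z ∈ boundaries L 2 → z = 0) :
    ∃ e ∈ L, e ∉ Γ ∧ e.card = 2 ∧ ∃ t ∈ L, t.card = 3 ∧ e ⊆ t ∧
      ∀ t' ∈ L, t'.card = 3 → e ⊆ t' → t' = t := by
  classical
  set T : Finset (Finset Plane) := hL.toFinset.filter fun s => s.card = 3 with hT
  have hmemT : ∀ s, s ∈ T ↔ s ∈ L ∧ s.card = 3 := fun s => by simp [hT]
  set c : Chain := Finsupp.indicator T fun _ _ => 1 with hc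
  have hcT : ∀ s, c s ≠ 0 ↔ s ∈ T := fun s => by
    by_cases hs : s ∈ T <;> simp [hc, hs]
  have hcL : c ∈ chains L 3 := mem_chains.2 fun s hs => (hmemT s).1 ((hcT s).1 hs)
  have hc0 : c ≠ 0 := fun h => ((hcT t).2 ((hmemT t).2 ⟨ht, htc⟩)) (by rw [h]; rfl)
  have hb0 : boundaryMap c ≠ 0 := fun h =>
    hc0 (eq_zero_of_boundaryMap_eq_zero (chains_mono hLK 3 hcL) h)
  have hbL : boundaryMap c ∈ chains L 2 := boundaryMap_mem_chains hcL fun s hs _ => hdown s hs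
  -- The boundary of the sum of all triangles cannot lie in `Γ`: it would be a bounding cycle there,
  -- hence zero.
  obtain ⟨e, he0, heΓ⟩ : ∃ e, boundaryMap c e ≠ 0 ∧ e ∉ Γ := by
    by_contra! h
    refine hb0 (hΓ _ ⟨mem_chains.2 fun s hs => ⟨h s hs, (mem_chains.1 hbL s hs).2⟩,
      boundaryMap_boundaryMap_of_chains_three hcL⟩ (mem_boundaries.2 ⟨c, hcL, rfl⟩))
  obtain ⟨heL, hec⟩ := mem_chains.1 hbL e he0
  obtain ⟨t, ht0, het, -⟩ := exists_coface_of_boundaryMap_apply_ne_zero he0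
  obtain ⟨htL, htc⟩ := mem_chains.1 hcL t ht0
  refine ⟨e, heL, heΓ, hec, t, htL, htc, het, fun t' htL' htc' het' => ?_⟩
  by_contra htt'
  have hsupp : c.support = T := Finset.ext fun s => by rw [Finsupp.mem_support_iff, hcT]
  refine he0 ?_
  -- At most two triangles contain `e`. If there were two, their contributions to the coefficient of
  -- `e` would cancel.
  have hval : ∀ s ∈ T, e ⊆ s → c s * simplexBoundary s e = 1 := fun s hs hes => by
    have hsc := ((hmemT s).1 hs).2
    rw [ZMod.eq_one_of_ne_zero_two ((hcT s).2 hs), simplexBoundary_apply (by omega),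
      if_pos ⟨hes, by omega⟩, mul_one]
  rw [boundaryMap_apply, hsupp, ← Finset.sum_subset (s₁ := {t', t})]
  · rw [Finset.sum_pair htt', hval t' ((hmemT t').2 ⟨htL', htc'⟩) het',
      hval t ((hmemT t).2 ⟨htL, htc⟩) het]
    exact CharTwo.add_self_eq_zero 1
  · intro s hs
    rcases Finset.mem_insert.1 hs with rfl | hs
    · exact (hmemT _).2 ⟨htL', htc'⟩
    · rw [Finset.mem_singleton.1 hs]
      exact (hmemT _).2 ⟨htL, htc⟩
  · intro s hs hst
    by_contra hne
    have hes := (simplexBoundary_apply_ne_zero (right_ne_zero_of_mul hne)).1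
    obtain ⟨hsL, hsc⟩ := (hmemT s).1 hs
    simp only [Finset.mem_insert, Finset.mem_singleton, not_or] at hst
    rcases eq_or_eq_or_eq_of_triangles hec (hLK hsL) (hLK htL') (hLK htL) hsc htc' htc hes het' het
      with h | h | h
    exacts [hst.1 h, hst.2 h, htt' h]

/-! ### First homology of a convex complex -/

theorem eq_singleton_or_pair_of_mem {s : Finset Plane} {v : Plane} (hs : s.card = 2) (hv : v ∈ s) :
    ∃ x, x ≠ v ∧ s = {v, x} := by
  obtain ⟨a, b, hab, rfl⟩ := Finset.card_eq_two.1 hs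
  rcases Finset.mem_insert.1 hv with rfl | hv
  · exact ⟨b, hab.symm, rfl⟩
  · rw [Finset.mem_singleton.1 hv]
    exact ⟨a, hab, Finset.pair_comm a b⟩

theorem affine_lt_of_mem_convexHull {r c : ℝ} {s : Set Plane} {x : Plane}
    (hx : x ∈ convexHull ℝ s) (h : ∀ y ∈ s, y 0 + r * y 1 < c) : x 0 + r * x 1 < c := by
  have hconv : Convex ℝ {y : Plane | y 0 + r * y 1 < c} := by
    intro y hy z hz a b ha hb hab
    simp only [Set.mem_ofPred_eq, PiLp.add_apply, PiLp.smul_apply, smul_eq_mul] at hy hz ⊢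
    have h1 : a * y 0 + b * z 0 + r * (a * y 1 + b * z 1) =
      a * (y 0 + r * y 1) + b * (z 0 + r * z 1) := by ring
    rw [h1]
    rcases ha.eq_or_lt with rfl | ha
    · obtain rfl : b = 1 := by linarith
      linarith
    · have h2 : c = a * c + b * c := by rw [← add_mul, hab, one_mul]
      linarith [mul_lt_mul_of_pos_left hy ha, mul_le_mul_of_nonneg_left hz.le hb]
  exact convexHull_min h hconv hx

theorem exists_lt_of_mem_convexHull {r c : ℝ} {s : Set Plane} {x : Plane}
    (hx : x ∈ convexHull ℝ s) (h : x 0 + r * x 1 < c) : ∃ y ∈ s, y 0 + r * y 1 < c := by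
  by_contra! h'
  have hconv : Convex ℝ {y : Plane | c ≤ y 0 + r * y 1} := by
    intro y hy z hz a b ha hb hab
    simp only [Set.mem_ofPred_eq, PiLp.add_apply, PiLp.smul_apply, smul_eq_mul] at hy hz ⊢
    have h1 : a * y 0 + b * z 0 + r * (a * y 1 + b * z 1) =
      a * (y 0 + r * y 1) + b * (z 0 + r * z 1) := by ring
    rw [h1]
    have h2 : c = a * c + b * c := by rw [← add_mul, hab, one_mul]
    linarith [mul_le_mul_of_nonneg_left hy ha, mul_le_mul_of_nonneg_left hz hb]
  exact absurd (convexHull_min h' hconv hx) (not_le.2 h)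

/-- In a convex complex, the part of the link of a vertex on one side of a line is connected. -/
theorem rel_of_lower_link {K : Geometry.SimplicialComplex ℝ Plane} (hfin : K.faces.Finite)
    (hconv : Convex ℝ K.space) (r : ℝ) {v a b : Plane} (ha : {v, a} ∈ K.faces)
    (hb : {v, b} ∈ K.faces) (hav : a 0 + r * a 1 < v 0 + r * v 1)
    (hbv : b 0 + r * b 1 < v 0 + r * v 1) {R : Plane → Plane → Prop} (hR : Equivalence R)
    (h : ∀ x y, {v, x, y} ∈ K.faces → x 0 + r * x 1 < v 0 + r * v 1 →
      y 0 + r * y 1 < v 0 + r * v 1 → R x y) : R a b := by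
  classical
  have hv : v ∈ K.vertices := K.down_closed ha (by simp) (Finset.singleton_nonempty v)
  -- A small ball around `v` misses all simplices that do not contain `v`.
  set Z := spaceOf {s | s ∈ K.faces ∧ v ∉ s} with hZ
  have hZc : IsClosed Z := isClosed_spaceOf (hfin.subset fun s hs => hs.1)
  have hvZ : v ∉ Z := fun hvZ => by
    obtain ⟨s, hs, hvs⟩ := mem_spaceOf.1 hvZ
    exact hs.2 ((K.vertex_mem_convexHull_iff hv hs.1).1 hvs)
  obtain ⟨ε, hε, hball⟩ := Metric.isOpen_iff.1 hZc.isOpen_compl v hvZ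
  have hnear : ∀ c : Plane, ∃ η : ℝ, 0 < η ∧ η ≤ 1 ∧ v + η • (c - v) ∈ Metric.ball v ε := by
    intro c
    have hc : Filter.Tendsto (fun η : ℝ => v + η • (c - v)) (nhdsWithin 0 (Set.Ioi 0)) (nhds v) := by
      have : Continuous fun η : ℝ => v + η • (c - v) := by fun_prop
      have h0 := this.tendsto 0
      rw [zero_smul, add_zero] at h0
      exact h0.mono_left nhdsWithin_le_nhds
    obtain ⟨η, h1, h2, h3⟩ := ((hc.eventually (Metric.ball_mem_nhds v hε)).and
      (Ioc_mem_nhdsGT (zero_lt_one' ℝ))).exists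
    exact ⟨η, h2, h3, h1⟩
  obtain ⟨η, hη0, hη1, hp⟩ := hnear a
  obtain ⟨θ, hθ0, hθ1, hq⟩ := hnear b
  have hon : ∀ (c : Plane) (η : ℝ), 0 < η → η ≤ 1 →
      v + η • (c - v) ∈ convexHull ℝ (({v, c} : Finset Plane) : Set Plane) := by
    intro c η h0 h1
    rw [Finset.coe_pair, convexHull_pair, segment_eq_image']
    exact ⟨η, ⟨h0.le, h1⟩, rfl⟩
  have hlow : ∀ (c : Plane) (η : ℝ), 0 < η → c 0 + r * c 1 < v 0 + r * v 1 →
      (v + η • (c - v)) 0 + r * (v + η • (c - v)) 1 < v 0 + r * v 1 := by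
    intro c η h0 hc
    simp only [PiLp.add_apply, PiLp.smul_apply, PiLp.sub_apply, smul_eq_mul]
    nlinarith
  -- The segment from `p` to `q` stays in K by convexity, near `v` and strictly below it. The
  -- simplices it crosses all contain `v` and link `a` to `b`.
  set p := v + η • (a - v) with hpdef
  set q := v + θ • (b - v) with hqdef
  have hpa := hon a η hη0 hη1
  have hqb := hon b θ hθ0 hθ1
  have hSK : segment ℝ p q ⊆ K.space := hconv.segment_subset
    (K.convexHull_subset_space ha hpa) (K.convexHull_subset_space hb hqb)
  have hSball : segment ℝ p q ⊆ Metric.ball v ε := (convex_ball v ε).segment_subset hp hq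
  have hSlow : ∀ x ∈ segment ℝ p q, x 0 + r * x 1 < v 0 + r * v 1 := by
    intro x hx
    rw [← convexHull_pair] at hx
    refine affine_lt_of_mem_convexHull hx ?_
    rintro y (rfl | rfl)
    exacts [hlow a η hη0 hav, hlow b θ hθ0 hbv]
  have hL : {s | s ∈ K.faces ∧ v ∈ s}.Finite := hfin.subset fun s hs => hs.1
  have hcover : segment ℝ p q ⊆ spaceOf {s | s ∈ K.faces ∧ v ∈ s} := by
    intro x hx
    obtain ⟨s, hs, hxs⟩ := mem_spaceOf.1 (hSK hx)
    refine mem_spaceOf.2 ⟨s, ⟨hs, ?_⟩, hxs⟩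
    by_contra hvs
    exact hball (hSball hx) (mem_spaceOf.2 ⟨s, ⟨hs, hvs⟩, hxs⟩)
  obtain ⟨x, hx, hxv, hax⟩ := (convex_segment p q).isPreconnected.color_eq hL hcover
    (c := fun s => ∃ x ∈ s, x 0 + r * x 1 < v 0 + r * v 1 ∧ R a x)
    (by
      rintro s ⟨hs, hvs⟩ t ⟨ht, hvt⟩ x hx hxs hxt ⟨y, hys, hyv, hay⟩
      -- Two simplices that meet at a point below `v` share a vertex `z` below `v`. Inside the first
      -- one, `v`, `y` and `z` span a face.
      obtain ⟨z, ⟨hzs, hzt⟩, hzv⟩ := exists_lt_of_mem_convexHull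
        (K.inter_subset_convexHull hs ht ⟨hxs, hxt⟩) (hSlow x hx)
      refine ⟨z, hzt, hzv, hR.trans hay (h y z (K.down_closed hs ?_ (by simp)) hyv hzv)⟩
      intro w hw
      simp only [Finset.mem_insert, Finset.mem_singleton] at hw
      rcases hw with rfl | rfl | rfl
      exacts [hvs, hys, hzs])
    (s := {v, a}) (t := {v, b}) ⟨ha, by simp⟩ ⟨hb, by simp⟩ (left_mem_segment ℝ p q) hpa
    (right_mem_segment ℝ p q) hqb ⟨a, by simp, hav, hR.refl a⟩
  rcases Finset.mem_insert.1 hx with rfl | hx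
  · exact absurd hxv (lt_irrefl _)
  · rwa [Finset.mem_singleton.1 hx] at hax

/-- A finite planar complex with convex underlying space has trivial first homology. -/
theorem cycles_le_boundaries {K : Geometry.SimplicialComplex ℝ Plane} (hfin : K.faces.Finite)
    (hconv : Convex ℝ K.space) : cycles K.faces 2 ≤ boundaries K.faces 2 := by
  classical
  have hVfin : K.vertices.Finite :=
    hfin.preimage (Finset.singleton_injective.injOn (s := _))
  obtain ⟨r, hr⟩ := exists_injOn_functional hVfin
  set h : Plane → ℝ := fun x => x 0 + r * x 1 with hh
  set V := hVfin.toFinset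
  have hV : ∀ x, x ∈ V ↔ x ∈ K.vertices := fun x => hVfin.mem_toFinset
  have hvert : ∀ s ∈ K.faces, ∀ x ∈ s, x ∈ K.vertices := fun s hs x hx =>
    K.down_closed hs (Finset.singleton_subset_iff.2 hx) (Finset.singleton_nonempty x)
  have key : ∀ n : ℕ, ∀ c : ℝ, (V.filter fun x => h x < c).card ≤ n → ∀ z ∈ cycles K.faces 2,
      (∀ s, z s ≠ 0 → ∀ x ∈ s, h x < c) → z ∈ boundaries K.faces 2 := by
    intro n
    induction n with
    | zero =>
      intro c hc z hz hzc
      have : z = 0 := by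
        by_contra hne
        obtain ⟨s, hs⟩ := Finsupp.support_nonempty_iff.2 hne
        have hs := Finsupp.mem_support_iff.1 hs
        have hsK := (mem_chains.1 hz.1 s hs).1
        obtain ⟨x, hx⟩ := K.nonempty_of_mem_faces hsK
        have : x ∈ V.filter fun x => h x < c :=
          Finset.mem_filter.2 ⟨(hV x).2 (hvert s hsK x hx), hzc s hs x hx⟩
        rw [Finset.card_eq_zero.1 (Nat.le_zero.1 hc)] at this
        exact absurd this (Finset.notMem_empty x)
      rw [this]
      exact Submodule.zero_mem _
    | succ n ih =>
      intro c hc z hz hzc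
      by_cases hne : (V.filter fun x => h x < c).Nonempty
      swap
      · exact ih c (by rw [Finset.not_nonempty_iff_eq_empty.1 hne]; simp) z hz hzc
      obtain ⟨v, hv, hvmax⟩ := Finset.exists_max_image _ h hne
      obtain ⟨hvV, hvc⟩ := Finset.mem_filter.1 hv
      have hlower : ∀ s, z s ≠ 0 → ∀ x ∈ s, x ≠ v → h x < h v := by
        intro s hs x hx hxv
        have hxV := hvert s (mem_chains.1 hz.1 s hs).1 x hx
        refine lt_of_le_of_ne (hvmax x (Finset.mem_filter.2 ⟨(hV x).2 hxV, hzc s hs x hx⟩)) ?_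
        exact fun he => hxv (hr hxV ((hV v).1 hvV) he)
      set L : Set (Finset Plane) := {s | s ∈ K.faces ∧ ∀ x ∈ s, h x < h v} with hL
      -- Modulo boundaries and edges strictly below the highest vertex `v`, the edges at `v` in `z`
      -- all become equal, because the lower link of `v` is connected.
      set M := boundaries K.faces 2 ⊔ chains L 2 with hM
      let e : Plane → Chain := fun x => Finsupp.single {v, x} 1
      let R : Plane → Plane → Prop := fun x y => e x + e y ∈ M
      have hR : Equivalence R :=
        { refl := fun x => by
            change e x + e x ∈ M
            rw [ZModModule.add_self]
            exact Submodule.zero_mem _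
          symm := fun {x y} hxy => by
            change e y + e x ∈ M
            rwa [add_comm]
          trans := fun {x y w} hxy hyw => by
            have h1 := Submodule.add_mem _ hxy hyw
            have h2 : e x + e y + (e y + e w) = e x + e w + (e y + e y) := by abel
            rwa [h2, ZModModule.add_self, add_zero] at h1 }
      have hRtri : ∀ x y, {v, x, y} ∈ K.faces → x 0 + r * x 1 < v 0 + r * v 1 →
          y 0 + r * y 1 < v 0 + r * v 1 → R x y := by
        intro x y hxy hx hy
        by_cases hne : x = y
        · rw [hne]
          exact hR.refl y
        have hvx : v ≠ x := by rintro rfl; exact lt_irrefl _ hx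
        have hvy : v ≠ y := by rintro rfl; exact lt_irrefl _ hy
        have h1 : simplexBoundary {v, x, y} ∈ M := by
          refine Submodule.mem_sup_left (mem_boundaries.2 ⟨_, single_mem_chains hxy ?_ 1,
            boundaryMap_single _⟩)
          exact Finset.card_eq_three.2 ⟨v, x, y, hvx, hvy, hne, rfl⟩
        have h2 : (Finsupp.single {x, y} 1 : Chain) ∈ M := by
          refine Submodule.mem_sup_right (single_mem_chains (L := L) ⟨K.down_closed hxy ?_ (by simp), ?_⟩
            (Finset.card_pair hne) 1)
          · exact Finset.subset_insert _ _
          · intro w hw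
            rcases Finset.mem_insert.1 hw with rfl | hw
            · exact hx
            · rw [Finset.mem_singleton.1 hw]
              exact hy
        have h3 := Submodule.sub_mem _ h1 h2
        rw [simplexBoundary_triple hvx hvy hne] at h3
        change e x + e y ∈ M
        have h4 : (Finsupp.single {x, y} 1 : Chain) + Finsupp.single {v, y} 1 +
          Finsupp.single {v, x} 1 - Finsupp.single {x, y} 1 = e x + e y := by
          simp only [e]
          abel
        rwa [h4] at h3
      obtain ⟨Q, hQ⟩ : ∃ Q, ∀ t, z t ≠ 0 →
          M.mkQ (Finsupp.single t 1) = simplexBoundary t {v} • Q := by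
        have hnot : ∀ t, z t ≠ 0 → v ∉ t → ∀ Q,
            M.mkQ (Finsupp.single t 1) = simplexBoundary t {v} • Q := by
          intro t ht hvt Q
          obtain ⟨htK, htc⟩ := mem_chains.1 hz.1 t ht
          rw [simplexBoundary_apply (by omega), if_neg (by simp [hvt]), zero_smul,
            Submodule.mkQ_apply, Submodule.Quotient.mk_eq_zero]
          refine Submodule.mem_sup_right (single_mem_chains (L := L) ⟨htK, fun x hx => ?_⟩ htc 1)
          exact hlower t ht x hx fun h => hvt (h ▸ hx)
        by_cases hex : ∃ t, z t ≠ 0 ∧ v ∈ t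
        · obtain ⟨t₀, ht₀, hvt₀⟩ := hex
          obtain ⟨ht₀K, ht₀c⟩ := mem_chains.1 hz.1 t₀ ht₀
          obtain ⟨a, hav, rfl⟩ := eq_singleton_or_pair_of_mem ht₀c hvt₀
          refine ⟨M.mkQ (e a), fun t ht => ?_⟩
          by_cases hvt : v ∈ t
          · obtain ⟨htK, htc⟩ := mem_chains.1 hz.1 t ht
            obtain ⟨x, hxv, rfl⟩ := eq_singleton_or_pair_of_mem htc hvt
            rw [simplexBoundary_apply (by omega), if_pos (by simp [htc]), one_smul, ← sub_eq_zero,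
              ← map_sub, Submodule.mkQ_apply, Submodule.Quotient.mk_eq_zero,
              ZModModule.sub_eq_add]
            exact rel_of_lower_link hfin hconv r htK ht₀K (hlower _ ht x (by simp) hxv)
              (hlower _ ht₀ a (by simp) hav) hR hRtri
          · exact hnot t ht hvt _
        · push Not at hex
          exact ⟨0, fun t ht => hnot t ht (hex t ht) 0⟩
      have hzM : z ∈ M := by
        rw [← Submodule.Quotient.mk_eq_zero, ← Submodule.mkQ_apply]
        have hz1 : z = ∑ t ∈ z.support, z t • (Finsupp.single t 1 : Chain) := by
          conv_lhs => rw [← Finsupp.sum_single z]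
          exact Finset.sum_congr rfl fun t _ => by rw [Finsupp.smul_single_one]
        rw [hz1, map_sum]
        -- A cycle has an even number of edges at `v`, so their equal classes add up to zero.
        have h0 : boundaryMap z {v} = 0 := by rw [hz.2]; rfl
        rw [boundaryMap_apply] at h0
        rw [Finset.sum_congr rfl fun t ht => by
          rw [map_smul, hQ t (Finsupp.mem_support_iff.1 ht), smul_smul], ← Finset.sum_smul, h0,
          zero_smul]
      obtain ⟨b, hb, y, hy, hby⟩ := Submodule.mem_sup.1 hzM
      have hb0 : boundaryMap b = 0 := by
        obtain ⟨d, hd, rfl⟩ := mem_boundaries.1 hb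
        exact boundaryMap_boundaryMap_of_chains_three hd
      rw [← hby]
      refine Submodule.add_mem _ hb (ih (h v) ?_ y ⟨chains_mono (fun s hs => hs.1) 2 hy, ?_⟩
        fun s hs => (mem_chains.1 hy s hs).1.2)
      · refine Nat.le_of_lt_succ (lt_of_lt_of_le (Finset.card_lt_card ?_) hc)
        refine Finset.ssubset_iff_of_subset (fun x hx => ?_) |>.2 ⟨v, hv, by simp⟩
        rw [Finset.mem_filter] at hx ⊢
        exact ⟨hx.1, hx.2.trans hvc⟩
      · have := (mem_cycles.1 hz).2
        rwa [← hby, map_add, hb0, zero_add] at this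
  intro z hz
  obtain ⟨c, hc⟩ := (hVfin.image h).bddAbove
  refine key _ (c + 1) le_rfl z hz fun s hs x hx => ?_
  have := hc ⟨x, hvert s (mem_chains.1 hz.1 s hs).1 x hx, rfl⟩
  linarith

/-! ### Connected complexes -/

/-- Simplices are coloured by whether they have a vertex homologous to `u`. Simplices that meet
share a vertex, so connectedness spreads the colour. -/
theorem single_add_single_mem_boundaries {N : Geometry.SimplicialComplex ℝ Plane}
    (hfin : N.faces.Finite) (hconn : IsPreconnected N.space) {u v : Plane} (hu : u ∈ N.vertices)
    (hv : v ∈ N.vertices) :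
    (Finsupp.single {u} 1 + Finsupp.single {v} 1 : Chain) ∈ boundaries N.faces 1 := by
  classical
  have hedge : ∀ s ∈ N.faces, ∀ x ∈ s, ∀ y ∈ s,
      (Finsupp.single {x} 1 + Finsupp.single {y} 1 : Chain) ∈ boundaries N.faces 1 := by
    intro s hs x hx y hy
    by_cases hxy : x = y
    · rw [hxy, ZModModule.add_self]
      exact Submodule.zero_mem _
    · refine mem_boundaries.2 ⟨_, single_mem_chains (N.down_closed hs ?_ (by simp))
        (Finset.card_pair hxy) 1, (boundaryMap_single _).trans (simplexBoundary_pair hxy)⟩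
      intro w hw
      rcases Finset.mem_insert.1 hw with rfl | hw
      · exact hx
      · rwa [Finset.mem_singleton.1 hw]
  obtain ⟨x, hx, hux⟩ := hconn.color_eq hfin (fun x hx => hx)
    (c := fun s => ∃ x ∈ s,
      (Finsupp.single {u} 1 + Finsupp.single {x} 1 : Chain) ∈ boundaries N.faces 1)
    (by
      rintro s hs t ht x - hxs hxt ⟨y, hys, huy⟩
      obtain ⟨z, hzs, hzt⟩ := convexHull_nonempty_iff.1
        ⟨x, N.inter_subset_convexHull hs ht ⟨hxs, hxt⟩⟩
      refine ⟨z, hzt, ?_⟩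
      have h1 := Submodule.add_mem _ huy (hedge s hs y hys z hzs)
      have h2 : (Finsupp.single {u} 1 + Finsupp.single {y} 1 +
          (Finsupp.single {y} 1 + Finsupp.single {z} 1) : Chain) =
          Finsupp.single {u} 1 + Finsupp.single {z} 1 +
            (Finsupp.single {y} 1 + Finsupp.single {y} 1) := by abel
      rwa [h2, ZModModule.add_self, add_zero] at h1)
    (s := {u}) (t := {v}) hu hv (x := u) (y := v) (N.vertices_subset_space hu) (by simp)
    (N.vertices_subset_space hv) (by simp)
    ⟨u, by simp, by rw [ZModModule.add_self]; exact Submodule.zero_mem _⟩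
  rwa [Finset.mem_singleton.1 hx] at hux

/-- The sum of the coefficients of a chain. -/
def augmentation : Chain →ₗ[ZMod 2] ZMod 2 := Finsupp.linearCombination (ZMod 2) fun _ => 1

theorem augmentation_boundaryMap {L : Set (Finset Plane)} {d : Chain} (hd : d ∈ chains L 2) :
    augmentation (boundaryMap d) = 0 := by
  rw [boundaryMap_eq_sum, map_sum]
  refine Finset.sum_eq_zero fun t ht => ?_
  obtain ⟨x, y, hxy, rfl⟩ :=
    Finset.card_eq_two.1 (mem_chains.1 hd t (Finsupp.mem_support_iff.1 ht)).2
  rw [map_smul, simplexBoundary_pair hxy, map_add]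
  simp only [augmentation, Finsupp.linearCombination_single, smul_eq_mul, mul_one]
  rw [CharTwo.add_self_eq_zero, mul_zero]

/-- In a connected complex a `0`-chain is homologous to a multiple of any vertex. -/
theorem sub_augmentation_smul_mem_boundaries {N : Geometry.SimplicialComplex ℝ Plane}
    (hfin : N.faces.Finite) (hconn : IsPreconnected N.space) {v : Plane} (hv : v ∈ N.vertices)
    {z : Chain} (hz : z ∈ chains N.faces 1) :
    z - augmentation z • Finsupp.single {v} 1 ∈ boundaries N.faces 1 := by
  have h1 : z - augmentation z • Finsupp.single {v} 1 =
      ∑ s ∈ z.support, z s • (Finsupp.single s 1 + Finsupp.single {v} 1 : Chain) := by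
    have h2 : ∑ s ∈ z.support, z s • (Finsupp.single s 1 : Chain) = z := by
      conv_rhs => rw [← Finsupp.sum_single z]
      exact Finset.sum_congr rfl fun t _ => by rw [Finsupp.smul_single_one]
    have h3 : augmentation z = ∑ s ∈ z.support, z s := by
      rw [augmentation, Finsupp.linearCombination_apply, Finsupp.sum]
      simp
    simp only [smul_add, Finset.sum_add_distrib]
    rw [h2, ← Finset.sum_smul, h3, ZModModule.sub_eq_add]
  rw [h1]
  refine Submodule.sum_mem _ fun s hs => Submodule.smul_mem _ _ ?_
  obtain ⟨hsN, hsc⟩ := mem_chains.1 hz s (Finsupp.mem_support_iff.1 hs)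
  obtain ⟨x, rfl⟩ := Finset.card_eq_one.1 hsc
  exact single_add_single_mem_boundaries hfin hconn hsN hv

/-! ### Collapsing a planar complex to a graph -/

theorem card_le_three {K : Geometry.SimplicialComplex ℝ Plane} {s : Finset Plane}
    (hs : s ∈ K.faces) : s.card ≤ 3 := by
  have h := (K.indep hs).card_le_finrank_succ
  rw [Fintype.card_coe] at h
  have h2 : Module.finrank ℝ Plane = 2 := by simp
  exact h.trans (Nat.succ_le_succ ((Submodule.finrank_le _).trans h2.le))

/-- A planar complex collapses to any graph in it that contains all vertices and carries its first
homology. -/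
theorem deformationRetractsOnto_graph {K : Geometry.SimplicialComplex ℝ Plane}
    {Γ : Set (Finset Plane)} :
    ∀ (n : ℕ) {L : Set (Finset Plane)} (_ : L.Finite) (_ : L.ncard ≤ n) (_ : L ⊆ K.faces)
      (_ : ∀ s ∈ L, ∀ r ⊆ s, r.Nonempty → r ∈ L) (_ : Γ ⊆ L) (_ : ∀ s ∈ Γ, s.card ≤ 2)
      (_ : ∀ s ∈ L, s.card = 1 → s ∈ Γ)
      (_ : ∀ z ∈ cycles Γ 2, z ∈ boundaries L 2 → z = 0)
      (_ : ∀ z ∈ cycles L 2, ∃ z' ∈ cycles Γ 2, z - z' ∈ boundaries L 2)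
      (_ : ∀ e ∈ L, e.card = 2 → simplexBoundary e ∈ boundaries Γ 1),
      DeformationRetractsOnto (spaceOf L) (spaceOf Γ) := by
  intro n
  induction n with
  | zero =>
    intro L hL hn _ _ hΓL _ _ _ _ _
    have h0 : L = ∅ := (Set.ncard_eq_zero hL).1 (Nat.le_zero.1 hn)
    subst h0
    rw [Set.subset_empty_iff.1 hΓL]
    exact .refl _
  | succ n ih =>
    intro L hL hn hLK hdown hΓL hΓ2 hvert hinj hsurj hspan
    by_cases hex : ∃ t ∈ L, t.card = 3
    · obtain ⟨t₀, ht₀, ht₀c⟩ := hex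
      obtain ⟨e, heL, heΓ, hec, t, htL, htc, het, huniq⟩ :=
        exists_free_edge hL hLK ht₀ ht₀c hdown hinj
      obtain ⟨a, ha⟩ := Finset.card_eq_one.1 (show (t \ e).card = 1 by
        rw [Finset.card_sdiff_of_subset het, htc, hec])
      obtain ⟨hat, hae⟩ := Finset.mem_sdiff.1 (ha ▸ Finset.mem_singleton_self a)
      have hte : t.erase a = e := by
        rw [← Finset.sdiff_singleton_eq_erase, ← ha, Finset.sdiff_sdiff_eq_self het]
      set L' : Set (Finset Plane) := L \ {e, t} with hL'
      have hL'L : L' ⊆ L := Set.sdiff_subset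
      have hins : insert (t.erase a) (insert t L') = L := by
        rw [hte, hL']
        ext s
        simp only [Set.mem_insert_iff, Set.mem_sdiff, Set.mem_singleton_iff]
        constructor
        · rintro (rfl | rfl | h)
          exacts [heL, htL, h.1]
        · intro h
          tauto
      have hfree : ∀ s ∈ L', ¬ e ⊆ s := by
        rintro s ⟨hsL, hs⟩ hes
        simp only [Set.mem_insert_iff, Set.mem_singleton_iff, not_or] at hs
        have h3 := card_le_three (hLK hsL)
        have h2 := Finset.card_le_card hes
        rcases h3.eq_or_lt with h | h
        · exact hs.2 (huniq s hsL h hes)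
        · exact hs.1 (Finset.eq_of_subset_of_card_le hes (by omega)).symm
      have hfacet : ∀ b ∈ t.erase a, t.erase b ∈ L' := by
        intro b hb
        have hba := Finset.ne_of_mem_erase hb
        have hbt := Finset.mem_of_mem_erase hb
        have hab : a ∈ t.erase b := Finset.mem_erase.2 ⟨hba.symm, hat⟩
        refine ⟨hdown t htL _ (Finset.erase_subset _ _) ⟨a, hab⟩, ?_⟩
        rintro (h | h)
        · exact hae (h ▸ hab)
        · exact Finset.notMem_erase b t (h.symm ▸ hbt)
      have hcol : DeformationRetractsOnto (spaceOf L) (spaceOf L') := by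
        have := deformationRetractsOnto_elementaryCollapse (hL.subset hL'L) (hL'L.trans hLK)
          (hLK htL) hat (by rw [hte]; exact Finset.card_pos.1 (by omega))
          (by rw [hte]; exact hfree) hfacet
        rwa [hins] at this
      refine hcol.trans (ih (hL.subset hL'L) ?_ (hL'L.trans hLK) ?_ ?_ hΓ2
        (fun s hs => hvert s (hL'L hs)) (fun z hz hzb => hinj z hz (boundaries_mono hL'L 2 hzb)) ?_
        (fun s hs => hspan s (hL'L hs)))
      · have : L'.ncard < L.ncard := Set.ncard_lt_ncard
          ⟨hL'L, fun h => (h heL).2 (Or.inl rfl)⟩ hL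
        omega
      · rintro s hs r hr hr0
        refine ⟨hdown s (hL'L hs) r hr hr0, ?_⟩
        rintro (rfl | h)
        · exact hfree s hs hr
        · obtain rfl : r = t := h
          exact hfree s hs (het.trans hr)
      · intro s hs
        refine ⟨hΓL hs, ?_⟩
        rintro (rfl | h)
        · exact heΓ hs
        · obtain rfl : s = t := h
          have := hΓ2 s hs
          omega
      · intro z hz
        obtain ⟨z', hz', hzz⟩ := hsurj z ⟨chains_mono hL'L 2 hz.1, hz.2⟩
        refine ⟨z', hz', ?_⟩
        obtain ⟨d, hd, hdz⟩ := mem_boundaries.1 hzz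
        -- Neither `z` nor `z'` contains the free edge `e`. As `t` is the only triangle on `e`, the
        -- filling `d` cannot use `t` and survives the collapse.
        have he0 : boundaryMap d e = 0 := by
          have h1 : z e = 0 := by
            by_contra h
            exact (mem_chains.1 hz.1 e h).1.2 (Or.inl rfl)
          have h2 : z' e = 0 := by
            by_contra h
            exact heΓ (mem_chains.1 hz'.1 e h).1
          rw [hdz, Finsupp.sub_apply, h1, h2, sub_zero]
        have hcof : ∀ s, d s ≠ 0 → ¬ e ⊆ s := by
          intro s hs hes
          obtain ⟨hsL, hsc⟩ := mem_chains.1 hd s hs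
          obtain ⟨s', hne, hs', hes'⟩ := exists_ne_coface he0 hs hes (by omega) (by omega)
          obtain ⟨hsL', hsc'⟩ := mem_chains.1 hd s' hs'
          exact hne ((huniq s' hsL' hsc' hes').trans (huniq s hsL hsc hes).symm)
        refine mem_boundaries.2 ⟨d, mem_chains.2 fun s hs => ?_, hdz⟩
        obtain ⟨hsL, hsc⟩ := mem_chains.1 hd s hs
        refine ⟨⟨hsL, ?_⟩, hsc⟩
        rintro (rfl | h)
        · exact hcof s hs subset_rfl
        · obtain rfl : s = t := h
          exact hcof s hs het
    · push Not at hex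
      have hLΓ : L ⊆ Γ := by
        intro s hs
        have h3 := card_le_three (hLK hs)
        have h0 := Finset.card_pos.2 (K.nonempty_of_mem_faces (hLK hs))
        have h4 := hex s hs
        have h5 : s.card = 1 ∨ s.card = 2 := by omega
        rcases h5 with h | h
        · exact hvert s hs h
        · obtain ⟨d, hd, hds⟩ := mem_boundaries.1 (hspan s hs h)
          -- The edge `s`, closed up by a chain `d` in `Γ`, is homologous to a cycle of `Γ`. Without
          -- triangles the two are equal, so `s` itself is in `Γ`.
          have hcyc : Finsupp.single s 1 - d ∈ cycles L 2 :=
            mem_cycles.2 ⟨Submodule.sub_mem _ (single_mem_chains hs h 1) (chains_mono hΓL 2 hd), by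
              rw [map_sub, boundaryMap_single, hds, sub_self]⟩
          obtain ⟨z', hz', hzz⟩ := hsurj _ hcyc
          obtain ⟨c, hc, hcz⟩ := mem_boundaries.1 hzz
          have hc0 : c = 0 := by
            ext q
            by_contra hq
            exact hex q (mem_chains.1 hc q hq).1 (mem_chains.1 hc q hq).2
          rw [hc0, map_zero] at hcz
          have h6 : (Finsupp.single s 1 : Chain) = z' + d := by
            rw [eq_comm, sub_sub, sub_eq_zero] at hcz
            rw [hcz, add_comm]
          have h7 : (Finsupp.single s 1 : Chain) ∈ chains Γ 2 := by
            rw [h6]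
            exact Submodule.add_mem _ hz'.1 hd
          exact (mem_chains.1 h7 s (by simp)).1
      rw [hLΓ.antisymm hΓL]
      exact .refl _

/-- The vertices of `X` and the edges to their parents. -/
def parentEdges (par : Plane → Plane) (X : Finset Plane) : Set (Finset Plane) :=
  {s | ∃ x ∈ X, s = {x} ∨ s = {x, par x}}

theorem finite_parentEdges (par : Plane → Plane) (X : Finset Plane) :
    (parentEdges par X).Finite := by
  refine ((X.finite_toSet.image fun x => ({x} : Finset Plane)).union
    (X.finite_toSet.image fun x => ({x, par x} : Finset Plane))).subset ?_
  rintro s ⟨x, hx, rfl | rfl⟩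
  · exact Or.inl ⟨x, hx, rfl⟩
  · exact Or.inr ⟨x, hx, rfl⟩

/-- A forest of vertices with parent edges that hangs on a complex can be pruned. -/
theorem deformationRetractsOnto_prune {K : Geometry.SimplicialComplex ℝ Plane}
    {B : Set (Finset Plane)} (hB : B.Finite) (hBK : B ⊆ K.faces) (par : Plane → Plane)
    (d : Plane → ℕ) :
    ∀ (n : ℕ) (X : Finset Plane) (_ : X.card = n) (_ : ∀ x ∈ X, ∀ s ∈ B, x ∉ s)
      (_ : ∀ x ∈ X, {x, par x} ∈ K.faces ∧ d (par x) < d x ∧ (par x ∈ X ∨ {par x} ∈ B)),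
      DeformationRetractsOnto (spaceOf (B ∪ parentEdges par X)) (spaceOf B) := by
  intro n
  induction n with
  | zero =>
    intro X hX _ _
    obtain rfl := Finset.card_eq_zero.1 hX
    have : parentEdges par ∅ = ∅ := Set.eq_empty_of_forall_notMem fun s ⟨x, hx, _⟩ =>
      Finset.notMem_empty x hx
    rw [this, Set.union_empty]
    exact .refl _
  | succ n ih =>
    intro X hX hXB hpar
    -- A deepest vertex is the parent of no other, so it is a free facet of its parent edge.
    obtain ⟨x, hx, hmax⟩ := Finset.exists_max_image X d (Finset.card_pos.1 (by omega))
    obtain ⟨hxK, hdx, hpx⟩ := hpar x hx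
    have hne : par x ≠ x := fun h => by rw [h] at hdx; exact lt_irrefl _ hdx
    have hnotpar : ∀ y ∈ X, par y ≠ x := fun y hy h => by
      have h1 := (hpar y hy).2.1
      have h2 := hmax y hy
      rw [h] at h1
      omega
    set X' := X.erase x with hX'
    have herase : ({x, par x} : Finset Plane).erase (par x) = {x} := by
      ext y
      simp only [Finset.mem_erase, Finset.mem_insert, Finset.mem_singleton]
      grind
    have hL : insert (({x, par x} : Finset Plane).erase (par x))
        (insert {x, par x} (B ∪ parentEdges par X')) = B ∪ parentEdges par X := by
      rw [herase]
      ext s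
      simp only [parentEdges, hX', Set.mem_insert_iff, Set.mem_union, Set.mem_ofPred_eq,
        Finset.mem_erase]
      constructor
      · rintro (h | h | h | ⟨y, ⟨-, hy⟩, h⟩)
        exacts [Or.inr ⟨x, hx, Or.inl h⟩, Or.inr ⟨x, hx, Or.inr h⟩, Or.inl h, Or.inr ⟨y, hy, h⟩]
      · rintro (h | ⟨y, hy, h⟩)
        · exact Or.inr (Or.inr (Or.inl h))
        · by_cases hyx : y = x
          · subst hyx
            rcases h with h | h
            exacts [Or.inl h, Or.inr (Or.inl h)]
          · exact Or.inr (Or.inr (Or.inr ⟨y, ⟨hyx, hy⟩, h⟩))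
    have hcol := deformationRetractsOnto_elementaryCollapse (K := K)
      (L := B ∪ parentEdges par X') (hB.union (finite_parentEdges par X'))
      (by
        rintro s (hs | ⟨y, hy, hs⟩)
        · exact hBK hs
        · have hyK := (hpar y (Finset.mem_of_mem_erase hy)).1
          rcases hs with rfl | rfl
          · exact K.down_closed hyK (by simp) (by simp)
          · exact hyK)
      hxK (a := par x) (by simp) (by rw [herase]; simp)
      (by
        rw [herase]
        intro s hs hxs
        have hxs := Finset.singleton_subset_iff.1 hxs
        rcases hs with hs | ⟨y, hy, hs⟩
        · exact hXB x hx s hs hxs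
        · obtain ⟨hyx, hyX⟩ := Finset.mem_erase.1 hy
          rcases hs with rfl | rfl
          · exact hyx (Finset.mem_singleton.1 hxs).symm
          · rcases Finset.mem_insert.1 hxs with h | h
            · exact hyx h.symm
            · exact hnotpar y hyX (Finset.mem_singleton.1 h).symm)
      (by
        rw [herase]
        intro b hb
        obtain rfl := Finset.mem_singleton.1 hb
        have : ({b, par b} : Finset Plane).erase b = {par b} :=
          Finset.erase_insert (by simpa using hne.symm)
        rw [this]
        rcases hpx with h | h
        · exact Or.inr ⟨par b, Finset.mem_erase.2 ⟨hne, h⟩, Or.inl rfl⟩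
        · exact Or.inl h)
    rw [hL] at hcol
    refine hcol.trans (ih X' ?_ (fun y hy => hXB y (Finset.mem_of_mem_erase hy)) fun y hy => ?_)
    · rw [hX', Finset.card_erase_of_mem hx, hX, Nat.add_sub_cancel]
    · obtain ⟨h1, h2, h3⟩ := hpar y (Finset.mem_of_mem_erase hy)
      refine ⟨h1, h2, h3.imp_left fun h => Finset.mem_erase.2 ⟨?_, h⟩⟩
      exact hnotpar y (Finset.mem_of_mem_erase hy)

theorem boundaryMap_mem_of_forall {L : Set (Finset Plane)} {M : Submodule (ZMod 2) Chain} {k : ℕ}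
    {d : Chain} (hd : d ∈ chains L k) (h : ∀ s ∈ L, s.card = k → simplexBoundary s ∈ M) :
    boundaryMap d ∈ M := by
  rw [boundaryMap_eq_sum]
  refine Submodule.sum_mem _ fun s hs => Submodule.smul_mem _ _ ?_
  have := mem_chains.1 hd s (Finsupp.mem_support_iff.1 hs)
  exact h s this.1 this.2

/-! ### Walks as chains -/

/-- The sum of the edges of a walk. -/
def walkChain {F : SimpleGraph Plane} : {u v : Plane} → F.Walk u v → Chain
  | _, _, .nil => 0
  | u, _, .cons (v := w) _ p => Finsupp.single {u, w} 1 + walkChain p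

theorem boundaryMap_walkChain {F : SimpleGraph Plane} {u v : Plane} (p : F.Walk u v) :
    boundaryMap (walkChain p) = Finsupp.single {u} 1 + Finsupp.single {v} 1 := by
  induction p with
  | nil => rw [walkChain, map_zero, ZModModule.add_self]
  | @cons u w v h p ih =>
    rw [walkChain, map_add, ih, boundaryMap_single, simplexBoundary_pair h.ne]
    have : (Finsupp.single {u} 1 + Finsupp.single {w} 1 +
        (Finsupp.single {w} 1 + Finsupp.single {v} 1) : Chain) =
        Finsupp.single {u} 1 + Finsupp.single {v} 1 +
          (Finsupp.single {w} 1 + Finsupp.single {w} 1) := by abel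
    rw [this, ZModModule.add_self, add_zero]

theorem exists_mem_edges_of_walkChain_ne_zero {F : SimpleGraph Plane} {u v : Plane}
    (p : F.Walk u v) {s : Finset Plane} (hs : walkChain p s ≠ 0) :
    ∃ x y, s(x, y) ∈ p.edges ∧ s = {x, y} := by
  induction p with
  | nil => exact absurd rfl hs
  | @cons u w v h p ih =>
    rw [walkChain, Finsupp.add_apply] at hs
    by_cases h' : s = {u, w}
    · exact ⟨u, w, by simp, h'⟩
    · rw [Finsupp.single_eq_of_ne h', zero_add] at hs
      obtain ⟨x, y, hxy, he⟩ := ih hs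
      exact ⟨x, y, by simp [hxy], he⟩

theorem sym2_eq_of_pair_eq {u v x y : Plane} (h : ({u, v} : Finset Plane) = {x, y}) :
    s(u, v) = s(x, y) := by
  have h1 : (({u, v} : Finset Plane) : Set Plane) = ({x, y} : Finset Plane) := by rw [h]
  rw [Finset.coe_pair, Finset.coe_pair] at h1
  have := Set.pair_eq_pair_iff.1 h1
  rw [Sym2.eq_iff]
  exact this

/-! ### The forest and the splitting of the filtration -/

namespace LowerStarFiltration

variable {K : Geometry.SimplicialComplex ℝ Plane} {f : Plane → ℝ} {S : LowerStarFiltration K f}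
  {δ : ℝ}

theorem forest_adj_mem_faces {u v : Plane} (h : (S.forest δ).Adj u v) : {u, v} ∈ K.faces := by
  obtain ⟨-, w, hw, -⟩ := h
  exact hw.2.1

/-- The last edge of a cycle in the filtration would have a boundary that bounds earlier edges,
whereas an edge paired with a vertex joins two components. -/
theorem forest_isAcyclic : (S.forest δ).IsAcyclic := by
  intro u c hc
  cases c with
  | nil => exact hc.ne_nil rfl
  | @cons _ w _ h p =>
    obtain ⟨-, he⟩ := (SimpleGraph.Walk.cons_isCycle_iff p h).1 hc
    set z := walkChain (SimpleGraph.Walk.cons h p) with hz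
    have hz0 : z ≠ 0 := by
      intro h0
      -- The first edge of a cycle does not recur, so its coefficient in the chain is 1.
      have h1 : walkChain p {u, w} = 0 := by
        by_contra h2
        obtain ⟨x, y, hxy, hs⟩ := exists_mem_edges_of_walkChain_ne_zero p h2
        exact he (sym2_eq_of_pair_eq hs ▸ hxy)
      have h2 : z {u, w} = 1 := by
        rw [hz, walkChain, Finsupp.add_apply, h1, Finsupp.single_eq_same, add_zero]
      rw [h0] at h2
      exact zero_ne_one h2
    have hzb : boundaryMap z = 0 := by rw [hz, boundaryMap_walkChain, ZModModule.add_self]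
    have hadj : ∀ s, z s ≠ 0 → ∃ x y, (S.forest δ).Adj x y ∧ s = {x, y} := by
      intro s hs
      obtain ⟨x, y, hxy, hse⟩ := exists_mem_edges_of_walkChain_ne_zero _ hs
      exact ⟨x, y, SimpleGraph.Walk.adj_of_mem_edges _ hxy, hse⟩
    obtain ⟨s, hs0, hs⟩ := S.exists_last hz0
    have hzs : z ∈ chains (S.upTo s) 2 := by
      refine mem_chains.2 fun r hr => ?_
      obtain ⟨x, y, hxy, rfl⟩ := hadj r hr
      exact ⟨⟨forest_adj_mem_faces hxy, hs _ hr⟩, Finset.card_pair hxy.ne⟩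
    obtain ⟨x, y, hxy, rfl⟩ := hadj s hs0
    have hmem := S.sub_single_mem_chains_before (forest_adj_mem_faces hxy) hzs hs0
    obtain ⟨-, v, hv, -⟩ := hxy
    refine hv.card_eq_and_notMem.2 ?_
    rw [Finset.card_singleton]
    refine mem_boundaries.2 ⟨_, hmem, ?_⟩
    rw [map_sub, hzb, boundaryMap_single, zero_sub, ZModModule.neg_eq_self]

/-- A subcomplex `N` that forms an initial segment of the filtration, so that the pairs within `N`
and within its complement, but no others, have persistence at most `δ`. -/
structure SplitsAt (S : LowerStarFiltration K f) (δ : ℝ)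
    (N : Geometry.SimplicialComplex ℝ Plane) : Prop where
  finite : K.faces.Finite
  convex : Convex ℝ K.space
  subset : N.faces ⊆ K.faces
  preconnected : IsPreconnected N.space
  initial : ∀ r ∈ N.faces, ∀ s ∈ K.faces, S.pos s ≤ S.pos r → s ∈ N.faces
  pers_le : ∀ s ∈ K.faces, ∀ t ∈ K.faces, (s ∈ N.faces ↔ t ∈ N.faces) → S.pairPersistence s t ≤ δ
  lt_pers : ∀ s ∈ N.faces, ∀ t ∈ K.faces, t ∉ N.faces → δ < S.pairPersistence s t

theorem exists_last_vertex {s : Finset Plane} (hs : s ∈ K.faces) : ∃ v, s ∈ lowerStar K S.pos v := by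
  obtain ⟨v, hv, h⟩ := s.exists_max_image (fun v => S.pos {v}) (K.nonempty_of_mem_faces hs)
  exact ⟨v, hs, hv, h⟩

end LowerStarFiltration

/-! ### The noise model splits the filtration at `N` -/

theorem mem_vertices_of_mem {K : Geometry.SimplicialComplex ℝ Plane} {s : Finset Plane} {v : Plane}
    (hs : s ∈ K.faces) (hv : v ∈ s) : v ∈ K.vertices :=
  K.down_closed hs (Finset.singleton_subset_iff.2 hv) (Finset.singleton_nonempty v)

theorem convex_unitSquare : Convex ℝ unitSquare := by
  intro x hx y hy a b ha hb hab i
  exact convex_Icc (0 : ℝ) 1 (hx i) (hy i) ha hb hab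

theorem simplexValue_le {f : Plane → ℝ} {s : Finset Plane} (hs : s.Nonempty) {c : ℝ}
    (h : ∀ v ∈ s, f v ≤ c) : simplexValue f s ≤ c := by
  refine csSup_le (Set.Nonempty.image f (Finset.coe_nonempty.2 hs)) ?_
  rintro _ ⟨v, hv, rfl⟩
  exact h v hv

theorem le_simplexValue {f : Plane → ℝ} {s : Finset Plane} {v : Plane} (hv : v ∈ s) :
    f v ≤ simplexValue f s :=
  le_csSup (s.finite_toSet.image f).bddAbove ⟨v, hv, rfl⟩

/-- Simplex values vary by at most ν ≤ δ within `N` and within its complement, and the gap between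
the two is at least β - ν > δ. By fullness, a simplex outside `N` has a vertex outside `N`, which
determines its range of values. -/
theorem IsApproximation.splitsAt {K N : Geometry.SimplicialComplex ℝ Plane}
    (hK : IsTriangulationOfSquare K) {G : Set Plane} (hGconn : IsConnected G) {ρ : Plane → ℝ}
    {β ν ω : ℝ} (hρ : IsApproximation K N G ρ β ν ω) {δ : ℝ} (hδ : δ ∈ Set.Ico ν (β - ν))
    (S : LowerStarFiltration K (fun x => -ρ x)) : S.SplitsAt δ N := by
  have hsub := hρ.subcomplex
  have hgap := hρ.gap
  have hνδ := hδ.1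
  have hδβ := hδ.2
  have hin : ∀ s ∈ N.faces, ∀ v ∈ s, β ≤ ρ v ∧ ρ v ≤ β + ν := fun s hs v hv =>
    hρ.density_inside v (mem_vertices_of_mem hs hv)
  -- The interval that contains the value at a vertex is nonempty.
  have hν : ∀ v ∈ K.vertices, 0 ≤ ν := by
    intro v hv
    by_cases hvN : v ∈ N.vertices
    · have := hρ.density_inside v hvN
      linarith [this.1, this.2]
    · have := hρ.density_outside v hv hvN
      linarith [this.1, this.2]
  have hout : ∀ s ∈ K.faces, s ∉ N.faces → ∃ v ∈ s, v ∉ N.vertices := by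
    intro s hs hsN
    by_contra! h
    exact hsN (hρ.full s hs h)
  have hNval : ∀ s ∈ N.faces, -(β + ν) ≤ simplexValue (fun x => -ρ x) s ∧
      simplexValue (fun x => -ρ x) s ≤ -β := by
    intro s hs
    have hne := N.nonempty_of_mem_faces hs
    refine ⟨?_, simplexValue_le hne fun v hv => neg_le_neg (hin s hs v hv).1⟩
    obtain ⟨v, hv⟩ := hne
    exact (neg_le_neg (hin s hs v hv).2).trans (le_simplexValue (f := fun x => -ρ x) hv)
  have hKval : ∀ s ∈ K.faces, s ∉ N.faces → -ν ≤ simplexValue (fun x => -ρ x) s ∧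
      simplexValue (fun x => -ρ x) s ≤ 0 := by
    intro s hs hsN
    constructor
    · obtain ⟨v, hv, hvN⟩ := hout s hs hsN
      exact (neg_le_neg (hρ.density_outside v (mem_vertices_of_mem hs hv) hvN).2).trans
        (le_simplexValue (f := fun x => -ρ x) hv)
    · refine simplexValue_le (K.nonempty_of_mem_faces hs) fun v hv => ?_
      have hvK := mem_vertices_of_mem hs hv
      have h0 := hν v hvK
      by_cases hvN : v ∈ N.vertices
      · have := (hρ.density_inside v hvN).1
        linarith
      · have := (hρ.density_outside v hvK hvN).1
        linarith
  refine ⟨hK.finite, hK.space_eq ▸ convex_unitSquare, hsub,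
    hρ.retracts.isPreconnected hGconn.isPreconnected, ?_, ?_, ?_⟩
  · intro r hr s hs hsr
    obtain ⟨v, hv⟩ := LowerStarFiltration.exists_last_vertex (S := S) (hsub hr)
    obtain ⟨w, hw⟩ := LowerStarFiltration.exists_last_vertex (S := S) hs
    have hvN := mem_vertices_of_mem hr hv.2.1
    -- Vertices of `N` precede all others. The lower stars inherit this order, since a simplex
    -- belongs to the star of its last vertex.
    have hlt : ∀ x ∈ K.vertices, x ∉ N.vertices → ∀ y ∈ N.vertices, S.pos {y} < S.pos {x} := by
      intro x hx hxN y hy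
      refine S.pos_vertex y (hsub hy) x hx ?_
      have h1 := (hρ.density_outside x hx hxN).2
      have h2 := (hρ.density_inside y hy).1
      have h3 := hν x hx
      linarith
    have hwK := mem_vertices_of_mem hs hw.2.1
    have hwN : w ∈ N.vertices := by
      by_contra hwN
      exact absurd (S.pos_lowerStar v (hsub hvN) w hwK (hlt w hwK hwN v hvN) r hv s hw)
        (not_lt.2 hsr)
    refine hρ.full s hs fun x hx => ?_
    by_contra hxN
    exact absurd (hlt x (mem_vertices_of_mem hs hx) hxN w hwN) (not_lt.2 (hw.2.2 x hx))
  · intro s hs t ht hst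
    rw [LowerStarFiltration.pairPersistence]
    by_cases hsN : s ∈ N.faces
    · linarith [(hNval s hsN).1, (hNval t (hst.1 hsN)).2]
    · have htN : t ∉ N.faces := fun h => hsN (hst.2 h)
      linarith [(hKval s hs hsN).1, (hKval t ht htN).2]
  · intro s hs t ht htN
    rw [LowerStarFiltration.pairPersistence]
    linarith [(hNval s hs).2, (hKval t ht htN).1]

/-! ### The critical graph -/

namespace LowerStarFiltration

variable {K N : Geometry.SimplicialComplex ℝ Plane} {f : Plane → ℝ} {S : LowerStarFiltration K f}
  {δ : ℝ}

variable (S) in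
/-- An edge is negative if it joins two components of the complex before it. -/
def IsNegative (e : Finset Plane) : Prop := simplexBoundary e ∉ boundaries (S.before e) 1

/-- The vertices of `N`, the negative edges of `N`, and the critical edges. -/
def criticalGraph (S : LowerStarFiltration K f) (δ : ℝ)
    (N : Geometry.SimplicialComplex ℝ Plane) : Set (Finset Plane) :=
  {s | s ∈ N.faces ∧ (s.card = 1 ∨ s.card = 2 ∧ (S.IsNegative s ∨ S.PersistenceExceeds δ s))}

namespace SplitsAt

theorem subset_before (h : S.SplitsAt δ N) {e : Finset Plane} (he : e ∈ K.faces)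
    (heN : e ∉ N.faces) : N.faces ⊆ S.before e := fun r hr =>
  ⟨h.subset hr, not_le.1 fun hle => heN (h.initial r hr e he hle)⟩

theorem upTo_subset (h : S.SplitsAt δ N) {e : Finset Plane} (he : e ∈ N.faces) :
    S.upTo e ⊆ N.faces := fun r hr => h.initial e he r hr.1 hr.2

theorem before_subset (h : S.SplitsAt δ N) {e : Finset Plane} (he : e ∈ N.faces) :
    S.before e ⊆ N.faces := (S.before_subset_upTo e).trans (h.upTo_subset he)

theorem finite_subcomplex (h : S.SplitsAt δ N) : N.faces.Finite := h.finite.subset h.subset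

/-- Since `N` is connected, a class of vertices born in `N` becomes homologous, by the end of `N`,
to zero or to a multiple of an older vertex. It cannot wait for a later edge. -/
theorem mem_of_isPair_vertex (h : S.SplitsAt δ N) {w : Plane} {e : Finset Plane}
    (hp : S.IsPair {w} e) (hw : {w} ∈ N.faces) : e ∈ N.faces := by
  by_contra heN
  have hcard := hp.card_eq_and_notMem.1
  obtain ⟨hwK, he, -, z, hz, hz1, z', hz', hzz⟩ := hp
  rw [Finset.card_singleton] at hz hz1 hz' hzz
  have hsub := h.subset_before he heN
  have haug : augmentation z = augmentation z' := by
    obtain ⟨d, hd, hdz⟩ := mem_boundaries.1 hzz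
    rw [← sub_eq_zero, ← map_sub, ← hdz]
    exact augmentation_boundaryMap hd
  have hzN : z ∈ chains N.faces 1 := chains_mono (h.upTo_subset hw) 1 hz.1
  -- If `z'` is zero, so is the augmentation of `z`, which then bounds in `N`. Otherwise `z'`
  -- provides a vertex older than `w`.
  by_cases h0 : z' = 0
  · have := sub_augmentation_smul_mem_boundaries h.finite_subcomplex h.preconnected hw hzN
    rw [haug, h0, map_zero, zero_smul] at this
    exact hz1 0 (Submodule.zero_mem _) (boundaries_mono hsub 1 this)
  · obtain ⟨s, hs⟩ := Finsupp.support_nonempty_iff.2 h0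
    obtain ⟨hsb, hsc⟩ := mem_chains.1 hz'.1 s (Finsupp.mem_support_iff.1 hs)
    obtain ⟨v, rfl⟩ := Finset.card_eq_one.1 hsc
    have hvN : v ∈ N.vertices := h.before_subset hw hsb
    have := sub_augmentation_smul_mem_boundaries h.finite_subcomplex h.preconnected hvN hzN
    have hch : (Finsupp.single {v} 1 : Chain) ∈ chains (S.before {w}) 1 :=
      single_mem_chains hsb hsc 1
    refine hz1 _ (Submodule.smul_mem _ _ ⟨hch, ?_⟩) (boundaries_mono hsub 1 this)
    exact boundaryMap_eq_zero_of_chains_one hch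

/-- The edge and its partner lie on the same side of `N`, so the threshold δ removes no negative
edge from the forest. -/
theorem exists_isPair_le (h : S.SplitsAt δ N) {e : Finset Plane} (he : e ∈ K.faces)
    (hcard : e.card = 2) (hneg : S.IsNegative e) :
    ∃ w, S.IsPair {w} e ∧ S.pairPersistence {w} e ≤ δ := by
  obtain ⟨w, hw⟩ := S.exists_isPair_of_notMem_boundaries he hcard hneg
  refine ⟨w, hw, h.pers_le _ hw.1 _ he ⟨h.mem_of_isPair_vertex hw, fun heN => ?_⟩⟩
  exact h.initial e heN _ hw.1 hw.2.2.1.le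

theorem forest_adj_iff (h : S.SplitsAt δ N) {u v : Plane} (huv : u ≠ v) :
    (S.forest δ).Adj u v ↔ {u, v} ∈ K.faces ∧ S.IsNegative {u, v} := by
  constructor
  · intro hadj
    refine ⟨forest_adj_mem_faces hadj, ?_⟩
    obtain ⟨-, w, hw, -⟩ := hadj
    have := hw.card_eq_and_notMem.2
    rwa [Finset.card_singleton] at this
  · rintro ⟨he, hneg⟩
    exact ⟨huv, h.exists_isPair_le he (Finset.card_pair huv) hneg⟩

/-- An edge that is not negative creates a cycle. -/
theorem _root_.LowerStarFiltration.exists_cycle {e : Finset Plane} (he : e ∈ K.faces)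
    (hcard : e.card = 2) (hpos : ¬ S.IsNegative e) : ∃ z ∈ cycles (S.upTo e) 2, z e ≠ 0 := by
  obtain ⟨d, hd, hde⟩ := mem_boundaries.1 (not_not.1 hpos)
  refine ⟨Finsupp.single e 1 - d, mem_cycles.2 ⟨Submodule.sub_mem _ ?_ ?_, ?_⟩, ?_⟩
  · exact single_mem_chains (L := S.upTo e) ⟨he, le_rfl⟩ hcard 1
  · exact chains_mono (S.before_subset_upTo e) 2 hd
  · rw [map_sub, boundaryMap_single, hde, sub_self]
  · have : d e = 0 := by
      by_contra h
      exact lt_irrefl _ (mem_chains.1 hd e h).1.2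
    rw [Finsupp.sub_apply, this, Finsupp.single_eq_same, sub_zero]
    exact one_ne_zero

/-- A negative edge has small persistence. A cycle-creating edge outside `N` is paired, because the
first homology of K vanishes, and its partner comes later, hence also outside `N`, so its
persistence is again small. -/
theorem of_persistenceExceeds (h : S.SplitsAt δ N) {e : Finset Plane} (he : e ∈ K.faces)
    (hcard : e.card = 2) (hpers : S.PersistenceExceeds δ e) :
    e ∈ N.faces ∧ ¬ S.IsNegative e ∧ ∀ t ∈ N.faces, ¬ S.IsPair e t := by
  have hneg : ¬ S.IsNegative e := fun hneg => by
    obtain ⟨w, hw, hle⟩ := h.exists_isPair_le he hcard hneg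
    exact absurd (hpers.2 _ hw) (not_lt.2 hle)
  have heN : e ∈ N.faces := by
    by_contra heN
    obtain ⟨z, hz, hze⟩ := exists_cycle he hcard hneg
    have hzK : z ∈ boundaries K.faces 2 := cycles_le_boundaries h.finite h.convex
      (mem_cycles.2 ⟨chains_mono (fun s hs => hs.1) 2 hz.1, hz.2⟩)
    obtain ⟨r, hrK, hrmax⟩ : ∃ r ∈ K.faces, ∀ s ∈ K.faces, S.pos s ≤ S.pos r :=
      Set.exists_max_image _ S.pos h.finite ⟨e, he⟩
    obtain ⟨t, ht, -⟩ := S.exists_isPair_of_mem_boundaries he (by rwa [hcard]) hze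
      (r := r) (by rw [hcard]; exact boundaries_mono (L' := S.upTo r) (fun s hs => ⟨hs, hrmax s hs⟩) 2 hzK)
    have htN : t ∉ N.faces := fun htN => heN (h.initial t htN e he ht.2.2.1.le)
    exact absurd (hpers.1 t ht) (not_lt.2 (h.pers_le e he t ht.2.1 (by simp [heN, htN])))
  exact ⟨heN, hneg, fun t htN ht =>
    absurd (hpers.1 t ht) (not_lt.2 (h.pers_le e he t ht.2.1 (by simp [heN, htN])))⟩

theorem negative_or_exists_isPair (h : S.SplitsAt δ N) {e : Finset Plane} (he : e ∈ N.faces)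
    (hcard : e.card = 2) (hpers : ¬ S.PersistenceExceeds δ e) :
    S.IsNegative e ∨ ∃ t ∈ N.faces, S.IsPair e t := by
  rw [PersistenceExceeds, not_and_or] at hpers
  push Not at hpers
  rcases hpers with ⟨t, ht, hle⟩ | ⟨t, ht, -⟩
  · refine Or.inr ⟨t, ?_, ht⟩
    by_contra htN
    exact absurd (h.lt_pers e he t ht.2.1 htN) (not_lt.2 hle)
  · obtain ⟨h1, h2⟩ := ht.card_eq_and_notMem
    left
    rwa [show t.card = 1 by omega] at h2

/-- Injectivity on first homology. The last edge of `z` is not negative, as the rest of `z` has the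
same boundary; so it is critical. If `z` bounded in `N`, that edge would be paired inside `N`. -/
theorem cycle_criticalGraph_eq_zero (h : S.SplitsAt δ N) {z : Chain}
    (hz : z ∈ cycles (S.criticalGraph δ N) 2) (hzb : z ∈ boundaries N.faces 2) : z = 0 := by
  by_contra h0
  obtain ⟨e, he0, hmax⟩ := S.exists_last h0
  obtain ⟨⟨heN, he⟩, hcard⟩ := mem_chains.1 hz.1 e he0
  have heK := h.subset heN
  have hzup : z ∈ chains (S.upTo e) 2 := mem_chains.2 fun s hs =>
    ⟨⟨h.subset (mem_chains.1 hz.1 s hs).1.1, hmax s hs⟩, (mem_chains.1 hz.1 s hs).2⟩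
  have hneg : ¬ S.IsNegative e := by
    refine not_not.2 (mem_boundaries.2
      ⟨_, S.sub_single_mem_chains_before heK hzup he0, ?_⟩)
    rw [map_sub, (mem_cycles.1 hz).2, boundaryMap_single, zero_sub, ZModModule.neg_eq_self]
  have hpers : S.PersistenceExceeds δ e := by
    rcases he with he | ⟨-, he | he⟩
    · omega
    · exact absurd he hneg
    · exact he
  obtain ⟨r, hrN, hrmax⟩ : ∃ r ∈ N.faces, ∀ s ∈ N.faces, S.pos s ≤ S.pos r :=
    Set.exists_max_image _ S.pos h.finite_subcomplex ⟨e, heN⟩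
  obtain ⟨t, ht, htr⟩ := S.exists_isPair_of_mem_boundaries heK (z := z)
    (by rw [hcard]; exact ⟨hzup, hz.2⟩) he0 (r := r)
    (by
      rw [hcard]
      exact boundaries_mono (L' := S.upTo r) (fun s hs => ⟨h.subset hs, hrmax s hs⟩) 2 hzb)
  exact (h.of_persistenceExceeds heK hcard hpers).2.2 t (h.initial r hrN t ht.2.1 htr) ht

/-- Surjectivity on first homology. The last edge of `z` outside the graph has a partner in `N`,
which yields a boundary ending at that edge. Adding it cancels the edge and introduces only earlier
ones, so the bound `n` decreases. -/
theorem exists_homologous_criticalGraph (h : S.SplitsAt δ N) :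
    ∀ (n : ℕ) (z : Chain) (_ : z ∈ cycles N.faces 2)
      (_ : ∀ s, z s ≠ 0 → s ∉ S.criticalGraph δ N → S.pos s < n),
      ∃ z' ∈ cycles (S.criticalGraph δ N) 2, z - z' ∈ boundaries N.faces 2 := by
  intro n
  induction n with
  | zero =>
    intro z hz hlt
    refine ⟨z, ⟨mem_chains.2 fun s hs => ⟨?_, (mem_chains.1 hz.1 s hs).2⟩, hz.2⟩, by simp⟩
    by_contra hsΓ
    exact Nat.not_lt_zero _ (hlt s hs hsΓ)
  | succ n ih =>
    intro z hz hlt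
    by_cases hex : ∃ e, z e ≠ 0 ∧ e ∉ S.criticalGraph δ N ∧ S.pos e = n
    · obtain ⟨e, he0, heΓ, hen⟩ := hex
      obtain ⟨heN, hcard⟩ := mem_chains.1 hz.1 e he0
      have heK := h.subset heN
      have hpers : ¬ S.PersistenceExceeds δ e := fun hp => heΓ ⟨heN, Or.inr ⟨hcard, Or.inr hp⟩⟩
      have hneg : ¬ S.IsNegative e := fun hp => heΓ ⟨heN, Or.inr ⟨hcard, Or.inl hp⟩⟩
      obtain ⟨t, htN, -, htK, het, y, hy, hy1, y', hy', hyy⟩ :=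
        (h.negative_or_exists_isPair heN hcard hpers).resolve_left hneg
      rw [hcard] at hy hy1 hy' hyy
      -- A cycle without `e` would itself be older than `e`, against the choice of `y`.
      have hye : y e ≠ 0 := by
        intro h0
        refine hy1 y ⟨S.mem_chains_before heK hy.1 h0, hy.2⟩ ?_
        rw [sub_self]
        exact Submodule.zero_mem _
      have hy'e : y' e = 0 := by
        by_contra hne
        exact lt_irrefl _ (mem_chains.1 hy'.1 e hne).1.2
      have hbup : y - y' ∈ cycles (S.upTo e) 2 := Submodule.sub_mem _ hy
        ⟨chains_mono (S.before_subset_upTo e) 2 hy'.1, hy'.2⟩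
      have hbN : y - y' ∈ cycles N.faces 2 :=
        ⟨chains_mono (h.upTo_subset heN) 2 hbup.1, hbup.2⟩
      have hbb := boundaries_mono (h.upTo_subset htN) 2 hyy
      obtain ⟨z', hz', hzz⟩ := ih (z - (y - y')) (Submodule.sub_mem _ hz hbN) (by
        intro s hs hsΓ
        have hse : s ≠ e := by
          rintro rfl
          refine hs ?_
          rw [Finsupp.sub_apply, Finsupp.sub_apply, hy'e, ZMod.eq_one_of_ne_zero_two he0,
            ZMod.eq_one_of_ne_zero_two hye, sub_zero, sub_self]
        have hsle : S.pos s ≤ n := by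
          by_cases hzs : z s = 0
          · rw [Finsupp.sub_apply, hzs, zero_sub, neg_ne_zero] at hs
            exact hen ▸ (mem_chains.1 hbup.1 s hs).1.2
          · exact Nat.le_of_lt_succ (hlt s hzs hsΓ)
        refine lt_of_le_of_ne hsle fun hsn => hse ?_
        have hsN : s ∈ N.faces :=
          (mem_chains.1 (Submodule.sub_mem _ hz hbN : z - (y - y') ∈ cycles N.faces 2).1 s hs).1
        exact S.pos_injOn (h.subset hsN) heK (hsn.trans hen.symm))
      refine ⟨z', hz', ?_⟩
      have := Submodule.add_mem _ hzz hbb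
      have heq : z - (y - y') - z' + (y - y') = z - z' := by abel
      rwa [heq] at this
    · push Not at hex
      refine ih z hz fun s hs hsΓ => ?_
      have h1 := hlt s hs hsΓ
      have h2 := hex s hs hsΓ
      omega

/-- As in Kruskal's algorithm: the ends of an edge that is not negative are already joined by
earlier edges, to which induction applies. -/
theorem simplexBoundary_mem_boundaries_criticalGraph (h : S.SplitsAt δ N) :
    ∀ (n : ℕ) (e : Finset Plane) (_ : e ∈ N.faces) (_ : e.card = 2) (_ : S.pos e < n),
      simplexBoundary e ∈ boundaries (S.criticalGraph δ N) 1 := by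
  intro n
  induction n with
  | zero => exact fun e _ _ hn => absurd hn (Nat.not_lt_zero _)
  | succ n ih =>
    intro e he hcard hn
    by_cases hneg : S.IsNegative e
    · exact mem_boundaries.2 ⟨_, single_mem_chains (L := S.criticalGraph δ N)
        ⟨he, Or.inr ⟨hcard, Or.inl hneg⟩⟩ hcard 1,
        boundaryMap_single e⟩
    · obtain ⟨d, hd, hde⟩ := mem_boundaries.1 (not_not.1 hneg)
      rw [← hde]
      exact boundaryMap_mem_of_forall hd fun s hs hsc =>
        ih s (h.before_subset he hs) hsc (lt_of_lt_of_le hs.2 (Nat.le_of_lt_succ hn))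

theorem criticalGraph_subset : S.criticalGraph δ N ⊆ N.faces := fun _ hs => hs.1

theorem deformationRetractsOnto_criticalGraph (h : S.SplitsAt δ N) :
    DeformationRetractsOnto N.space (spaceOf (S.criticalGraph δ N)) := by
  refine deformationRetractsOnto_graph (K := K) N.faces.ncard h.finite_subcomplex le_rfl h.subset
    (fun s hs r hr hr0 => N.down_closed hs hr hr0) criticalGraph_subset ?_
    (fun s hs hc => ⟨hs, Or.inl hc⟩) (fun z hz => h.cycle_criticalGraph_eq_zero hz) ?_ ?_
  · rintro s ⟨-, hs | ⟨hs, -⟩⟩ <;> omega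
  · intro z hz
    obtain ⟨n, hn⟩ : ∃ n, ∀ s, z s ≠ 0 → S.pos s < n := by
      by_cases h0 : z = 0
      · exact ⟨0, fun s hs => absurd (by rw [h0]; rfl) hs⟩
      · obtain ⟨s, -, hs⟩ := S.exists_last h0
        exact ⟨S.pos s + 1, fun r hr => Nat.lt_succ_of_le (hs r hr)⟩
    exact h.exists_homologous_criticalGraph n z hz fun s hs _ => hn s hs
  · exact fun e he hc => h.simplexBoundary_mem_boundaries_criticalGraph _ e he hc (Nat.lt_succ_self _)

end SplitsAt

end LowerStarFiltration

/-! ### Pruning the critical graph to the output -/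

theorem SimpleGraph.Walk.IsPath.exists_eq_cons {V : Type*} {F : SimpleGraph V} {x r : V}
    {p : F.Walk x r} (hp : p.IsPath) (hne : x ≠ r) :
    ∃ (y : V) (hadj : F.Adj x y) (q : F.Walk y r), q.IsPath ∧ p = .cons hadj q := by
  cases p with
  | nil => exact absurd rfl hne
  | cons hadj q => exact ⟨_, hadj, q, hp.of_cons, rfl⟩

namespace LowerStarFiltration

variable {K N : Geometry.SimplicialComplex ℝ Plane} {f : Plane → ℝ} {S : LowerStarFiltration K f}
  {δ : ℝ}

/-- The part of the forest that lies in `N`. -/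
def innerForest (S : LowerStarFiltration K f) (δ : ℝ) (N : Geometry.SimplicialComplex ℝ Plane) :
    SimpleGraph Plane where
  Adj u v := (S.forest δ).Adj u v ∧ {u, v} ∈ N.faces
  symm := ⟨fun u v h => ⟨h.1.symm, by rw [Finset.pair_comm]; exact h.2⟩⟩
  loopless := ⟨fun _ h => h.1.ne rfl⟩

theorem innerForest_le : S.innerForest δ N ≤ S.forest δ := fun _ _ h => h.1

theorem innerForest_isAcyclic : (S.innerForest δ N).IsAcyclic := forest_isAcyclic.anti innerForest_le

theorem innerForest_adj_right {u v : Plane} (h : (S.innerForest δ N).Adj u v) : v ∈ N.vertices :=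
  mem_vertices_of_mem h.2 (by simp)

theorem mem_vertices_of_mem_support {u v : Plane} (p : (S.innerForest δ N).Walk u v)
    (hu : u ∈ N.vertices) : ∀ y ∈ p.support, y ∈ N.vertices := by
  induction p with
  | nil =>
    intro y hy
    rw [SimpleGraph.Walk.support_nil, List.mem_singleton] at hy
    exact hy ▸ hu
  | cons h p ih =>
    intro y hy
    rw [SimpleGraph.Walk.support_cons, List.mem_cons] at hy
    rcases hy with rfl | hy
    · exact hu
    · exact ih (innerForest_adj_right h) y hy

theorem mem_vertices_of_reachable {u v : Plane} (hu : u ∈ K.vertices)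
    (h : (S.forest δ).Reachable u v) : v ∈ K.vertices := by
  obtain ⟨p⟩ := h
  induction p with
  | nil => exact hu
  | cons h p ih => exact ih (mem_vertices_of_mem (forest_adj_mem_faces h) (by simp))

namespace SplitsAt

theorem innerForest_adj_iff (h : S.SplitsAt δ N) {u v : Plane} (huv : u ≠ v) :
    (S.innerForest δ N).Adj u v ↔ {u, v} ∈ N.faces ∧ S.IsNegative {u, v} :=
  ⟨fun ha => ⟨ha.2, ((h.forest_adj_iff huv).1 ha.1).2⟩,
    fun ha => ⟨(h.forest_adj_iff huv).2 ⟨h.subset ha.1, ha.2⟩, ha.1⟩⟩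

theorem reachable_of_edge (h : S.SplitsAt δ N) :
    ∀ (n : ℕ) (x y : Plane) (_ : x ≠ y) (_ : {x, y} ∈ N.faces) (_ : S.pos {x, y} < n),
      (S.innerForest δ N).Reachable x y := by
  intro n
  induction n with
  | zero => exact fun _ _ _ _ hn => absurd hn (Nat.not_lt_zero _)
  | succ n ih =>
    intro x y hxy he hn
    by_cases hneg : S.IsNegative {x, y}
    · exact ((h.innerForest_adj_iff hxy).2 ⟨he, hneg⟩).reachable
    · obtain ⟨d, hd, hde⟩ := mem_boundaries.1 (not_not.1 hneg)
      rw [simplexBoundary_pair hxy] at hde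
      refine rel_of_boundaryMap_eq (S.innerForest δ N).reachable_is_equivalence hd ?_ hde
      rintro s hs a b rfl hab
      exact ih a b hab (h.before_subset he hs) (lt_of_lt_of_le hs.2 (Nat.le_of_lt_succ hn))

/-- The negative edges of `N` span it, because `N` is connected and every edge can be replaced by a
walk of negative ones. -/
theorem reachable (h : S.SplitsAt δ N) {u v : Plane} (hu : u ∈ N.vertices) (hv : v ∈ N.vertices) :
    (S.innerForest δ N).Reachable u v := by
  obtain ⟨d, hd, hde⟩ := mem_boundaries.1
    (single_add_single_mem_boundaries h.finite_subcomplex h.preconnected hu hv)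
  refine rel_of_boundaryMap_eq (S.innerForest δ N).reachable_is_equivalence hd ?_ hde
  rintro s hs a b rfl hab
  exact h.reachable_of_edge _ a b hab hs (Nat.lt_succ_self _)

/-- The complex `N` deformation retracts onto the output graph together with the root. -/
theorem deformationRetractsOnto_output (h : S.SplitsAt δ N) (hne : N.vertices.Nonempty) :
    ∃ r, DeformationRetractsOnto N.space (spaceOf (S.output δ ∪ {{r}})) ∧
      ((S.output δ).Nonempty → {r} ∈ S.output δ) := by
  classical
  have hVfin : N.vertices.Finite := h.finite_subcomplex.preimage (Finset.singleton_injective.injOn (s := _))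
  obtain ⟨r, hr, hrmin⟩ := Set.exists_min_image N.vertices (fun v => S.pos {v}) hVfin hne
  -- The first vertex of `N` is first in K, as `N` is an initial segment. It is therefore the sink
  -- of every vertex of `N`.
  have hrminK : ∀ v ∈ K.vertices, S.pos {r} ≤ S.pos {v} := fun v hv => by
    by_contra hlt
    exact hlt (hrmin v (h.initial {r} hr {v} hv (not_le.1 hlt).le))
  have hsink : ∀ u ∈ N.vertices, ∀ r', S.IsSink δ u r' ↔ r' = r := by
    intro u hu r'
    have hur : (S.forest δ).Reachable u r := (h.reachable hu hr).mono innerForest_le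
    constructor
    · rintro ⟨h1, h2⟩
      have hr' := mem_vertices_of_reachable (h.subset hu) h1
      have := S.pos_injOn hr' (h.subset hr) (le_antisymm (h2 r hur) (hrminK r' hr'))
      exact Finset.singleton_injective this
    · rintro rfl
      exact ⟨hur, fun w hw => hrminK w (mem_vertices_of_reachable (h.subset hu) hw)⟩
  have hpath : ∀ x ∈ N.vertices, ∃ p : (S.innerForest δ N).Walk x r, p.IsPath := fun x hx => by
    obtain ⟨p, hp⟩ := (h.reachable hx hr).exists_isPath
    exact ⟨p, hp⟩
  choose P hP using hpath
  have huniq : ∀ x hx (p : (S.innerForest δ N).Walk x r), p.IsPath → P x hx = p :=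
    fun x hx p hp => congrArg Subtype.val
      ((innerForest_isAcyclic.subsingleton_path x r).elim ⟨P x hx, hP x hx⟩ ⟨p, hp⟩)
  -- The spanning tree rooted at `r`: the parent is the next vertex on the path to `r`, and `d` is
  -- the depth. The values outside `N` are arbitrary.
  let par : Plane → Plane := fun x => if hx : x ∈ N.vertices then (P x hx).snd else x
  let d : Plane → ℕ := fun x => if hx : x ∈ N.vertices then (P x hx).length else 0
  have hpar_def : ∀ x hx, par x = (P x hx).snd := fun x hx => dif_pos hx
  have hd_def : ∀ x hx, d x = (P x hx).length := fun x hx => dif_pos hx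
  have hpar : ∀ x (hx : x ∈ N.vertices), x ≠ r → (S.innerForest δ N).Adj x (par x) ∧
      d (par x) < d x ∧ s(x, par x) ∈ (P x hx).edges := by
    intro x hx hxr
    obtain ⟨y, hadj, q, hq, hpq⟩ := (hP x hx).exists_eq_cons hxr
    have hy := innerForest_adj_right hadj
    have hxy : par x = y := by rw [hpar_def x hx, hpq, SimpleGraph.Walk.snd_cons]
    rw [hxy, hd_def x hx, hd_def y hy, huniq y hy q hq, hpq]
    exact ⟨hadj, by simp, by simp⟩
  have hadj_par : ∀ x y, (S.innerForest δ N).Adj x y → y = par x ∨ x = par y := by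
    intro x y hxy
    have hy := innerForest_adj_right hxy
    have hx := innerForest_adj_right hxy.symm
    by_cases hys : y ∈ (P x hx).support
    · left
      rw [hpar_def x hx]
      exact innerForest_isAcyclic.eq_snd_of_adj_start (hP x hx) hxy hys
    -- If the path from `x` avoids `y`, prepending the edge gives the path from `y`, so `x` is the
    -- parent of `y`.
    · right
      rw [hpar_def y hy, huniq y hy (.cons hxy.symm (P x hx)) ((hP x hx).cons hys),
        SimpleGraph.Walk.snd_cons]
  have hpts : ∀ u hu s, s ∈ S.pathToSink δ u ↔ (∃ x ∈ (P u hu).support, s = {x}) ∨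
      ∃ x y, s(x, y) ∈ (P u hu).edges ∧ s = {x, y} := by
    intro u hu s
    have hmap := (hP u hu).mapLe (innerForest_le (S := S) (δ := δ) (N := N))
    constructor
    · rintro ⟨r', hr', p, hp, hs⟩
      obtain rfl := (hsink u hu r').1 hr'
      -- Paths in the whole forest are unique, so the path from `u` to the sink never leaves `N`.
      have heq : (P u hu).mapLe innerForest_le = p := congrArg Subtype.val
        ((forest_isAcyclic.subsingleton_path u r').elim ⟨_, hmap⟩ ⟨p, hp⟩)
      rwa [← heq, SimpleGraph.Walk.support_mapLe_eq_support,
        SimpleGraph.Walk.edges_mapLe_eq_edges] at hs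
    · intro hs
      refine ⟨r, (hsink u hu r).2 rfl, _, hmap, ?_⟩
      rwa [SimpleGraph.Walk.support_mapLe_eq_support, SimpleGraph.Walk.edges_mapLe_eq_edges]
  have hcrit : ∀ e ∈ K.faces, e.card = 2 → S.PersistenceExceeds δ e → ∀ u ∈ e, u ∈ N.vertices :=
    fun e he hc hp u hu => mem_vertices_of_mem (h.of_persistenceExceeds he hc hp).1 hu
  -- The root is added because the output is empty when there is no critical edge.
  set B := S.output δ ∪ {{r}} with hB
  have hedge_adj : ∀ {u v : Plane} {x y : Plane} (p : (S.innerForest δ N).Walk u v),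
      s(x, y) ∈ p.edges → (S.innerForest δ N).Adj x y := fun p hp => p.adj_of_mem_edges hp
  have hBΓ : B ⊆ S.criticalGraph δ N := by
    rintro s (⟨e, he, hc, hp, rfl | ⟨u, hu, hs⟩⟩ | rfl)
    · exact ⟨(h.of_persistenceExceeds he hc hp).1, Or.inr ⟨hc, Or.inr hp⟩⟩
    · have huN := hcrit e he hc hp u hu
      rcases (hpts u huN s).1 hs with ⟨x, hx, rfl⟩ | ⟨x, y, hxy, rfl⟩
      · exact ⟨mem_vertices_of_mem_support _ huN x hx, Or.inl (Finset.card_singleton x)⟩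
      · have hadj := hedge_adj _ hxy
        have := (h.innerForest_adj_iff hadj.ne).1 hadj
        exact ⟨this.1, Or.inr ⟨Finset.card_pair hadj.ne, Or.inl this.2⟩⟩
    · exact ⟨hr, Or.inl (Finset.card_singleton r)⟩
  have hBvert : ∀ s ∈ B, ∀ x ∈ s, {x} ∈ B := by
    rintro s (⟨e, he, hc, hp, rfl | ⟨u, hu, hs⟩⟩ | rfl) x hx
    · have hxN := hcrit s he hc hp x hx
      exact Or.inl ⟨s, he, hc, hp, Or.inr ⟨x, hx, (hpts x hxN _).2
        (Or.inl ⟨x, SimpleGraph.Walk.start_mem_support _, rfl⟩)⟩⟩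
    · have huN := hcrit e he hc hp u hu
      refine Or.inl ⟨e, he, hc, hp, Or.inr ⟨u, hu, (hpts u huN _).2 (Or.inl ⟨x, ?_, rfl⟩)⟩⟩
      rcases (hpts u huN s).1 hs with ⟨y, hy, rfl⟩ | ⟨y, z, hyz, rfl⟩
      · rwa [Finset.mem_singleton.1 hx]
      · rcases Finset.mem_insert.1 hx with rfl | hx
        · exact SimpleGraph.Walk.fst_mem_support_of_mem_edges _ hyz
        · rw [Finset.mem_singleton.1 hx]
          exact SimpleGraph.Walk.snd_mem_support_of_mem_edges _ hyz
    · exact Or.inr (by rw [Finset.mem_singleton.1 hx]; rfl)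
  have hBpar : ∀ x ∈ N.vertices, x ≠ r → {x} ∈ B → {x, par x} ∈ B := by
    rintro x hxN hxr (⟨e, he, hc, hp, rfl | ⟨u, hu, hs⟩⟩ | hx)
    · simp at hc
    · have huN := hcrit e he hc hp u hu
      have hxs : x ∈ (P u huN).support := by
        rcases (hpts u huN _).1 hs with ⟨y, hy, hxy⟩ | ⟨y, z, hyz, hx⟩
        · rwa [Finset.singleton_injective hxy]
        · have h1 := Finset.card_pair (hedge_adj _ hyz).ne
          rw [← hx] at h1
          simp at h1
      refine Or.inl ⟨e, he, hc, hp, Or.inr ⟨u, hu, (hpts u huN _).2 (Or.inr ⟨x, par x, ?_, rfl⟩)⟩⟩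
      -- The path from `x` to the root is the tail of the path from `u`, so its first edge is in the
      -- output too.
      have h1 := (hpar x hxN hxr).2.2
      rw [huniq x hxN _ ((hP u huN).dropUntil hxs)] at h1
      exact SimpleGraph.Walk.edges_dropUntil_subset_edges _ hxs h1
    · exact absurd (Finset.singleton_injective hx) hxr
  set X := hVfin.toFinset.filter fun x => {x} ∉ B with hX
  have hmemX : ∀ x, x ∈ X ↔ x ∈ N.vertices ∧ {x} ∉ B := fun x => by simp [hX]
  have hXr : ∀ x ∈ X, x ≠ r := by
    rintro x hx rfl
    exact ((hmemX x).1 hx).2 (Or.inr rfl)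
  -- Every tree edge is a parent edge. It lies in `B` if its lower end does, and hangs on `B` as
  -- part of a branch otherwise.
  have hΓ : B ∪ parentEdges par X = S.criticalGraph δ N := by
    apply Set.Subset.antisymm
    · refine Set.union_subset hBΓ ?_
      rintro s ⟨x, hx, hs⟩
      have hxN := ((hmemX x).1 hx).1
      rcases hs with rfl | rfl
      · exact ⟨hxN, Or.inl (Finset.card_singleton x)⟩
      · have hadj := (hpar x hxN (hXr x hx)).1
        have := (h.innerForest_adj_iff hadj.ne).1 hadj
        exact ⟨this.1, Or.inr ⟨Finset.card_pair hadj.ne, Or.inl this.2⟩⟩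
    · have hedge : ∀ x ∈ N.vertices, (S.innerForest δ N).Adj x (par x) →
          {x, par x} ∈ B ∪ parentEdges par X := by
        intro x hxN hadj
        have hxr : x ≠ r := by
          rintro rfl
          refine hadj.ne ?_
          -- The `snd` of the empty walk is its start, so the root is its own parent and no edge
          -- joins the two.
          rw [hpar_def x hxN, huniq x hxN .nil .nil]
          rfl
        by_cases hxB : {x} ∈ B
        · exact Or.inl (hBpar x hxN hxr hxB)
        · exact Or.inr ⟨x, (hmemX x).2 ⟨hxN, hxB⟩, Or.inr rfl⟩
      rintro s ⟨hsN, hc | ⟨hc, hneg | hp⟩⟩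
      · obtain ⟨x, rfl⟩ := Finset.card_eq_one.1 hc
        by_cases hxB : {x} ∈ B
        · exact Or.inl hxB
        · exact Or.inr ⟨x, (hmemX x).2 ⟨hsN, hxB⟩, Or.inl rfl⟩
      · obtain ⟨x, y, hxy, rfl⟩ := Finset.card_eq_two.1 hc
        have hadj := (h.innerForest_adj_iff hxy).2 ⟨hsN, hneg⟩
        rcases hadj_par x y hadj with rfl | rfl
        · exact hedge x (innerForest_adj_right hadj.symm) hadj
        · rw [Finset.pair_comm]
          exact hedge y (innerForest_adj_right hadj) hadj.symm
      · exact Or.inl (Or.inl ⟨s, h.subset hsN, hc, hp, Or.inl rfl⟩)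
  refine ⟨r, h.deformationRetractsOnto_criticalGraph.trans ?_, ?_⟩
  · rw [← hΓ]
    have hBN : B ⊆ N.faces := hBΓ.trans criticalGraph_subset
    refine deformationRetractsOnto_prune (h.finite_subcomplex.subset hBN) (hBN.trans h.subset) par d _ X rfl
      (fun x hx s hs hxs => ((hmemX x).1 hx).2 (hBvert s hs x hxs)) fun x hx => ?_
    obtain ⟨hadj, hlt, -⟩ := hpar x ((hmemX x).1 hx).1 (hXr x hx)
    refine ⟨h.subset hadj.2, hlt, ?_⟩
    by_cases hB' : {par x} ∈ B
    · exact Or.inr hB'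
    · exact Or.inl ((hmemX _).2 ⟨innerForest_adj_right hadj, hB'⟩)
  · rintro ⟨s, e, he, hc, hp, -⟩
    obtain ⟨u, hu⟩ := K.nonempty_of_mem_faces he
    exact ⟨e, he, hc, hp, Or.inr ⟨u, hu, (hpts u (hcrit e he hc hp u hu) _).2
      (Or.inl ⟨r, SimpleGraph.Walk.end_mem_support _, rfl⟩)⟩⟩

end SplitsAt

end LowerStarFiltration

end

theorem mainTheorem4
    (K N : Geometry.SimplicialComplex ℝ Plane) (hK : IsTriangulationOfSquare K)
    (G : Set Plane) (hG : IsEmbeddedGraph G) (hGconn : IsConnected G)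
    (ρ : Plane → ℝ) (β ν ω : ℝ) (hρ : IsApproximation K N G ρ β ν ω)
    (δ : ℝ) (hδ : δ ∈ Set.Ico ν (β - ν))
    (S : LowerStarFiltration K (fun x => -ρ x)) :
    DeformationRetractsOnto N.space G ∧
      (¬ ContractibleSpace G → DeformationRetractsOnto N.space (S.outputSpace δ)) := by
  refine ⟨hρ.retracts, fun hcontr => ?_⟩
  have h := hρ.splitsAt hK hGconn hδ S
  have hne : N.vertices.Nonempty := by
    obtain ⟨x, hx⟩ := hGconn.nonempty
    obtain ⟨s, hs, -⟩ := mem_spaceOf.1 (hρ.graph_subset hx)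
    obtain ⟨v, hv⟩ := N.nonempty_of_mem_faces hs
    exact ⟨v, mem_vertices_of_mem hs hv⟩
  obtain ⟨r, hdr, hr⟩ := h.deformationRetractsOnto_output hne
  rcases (S.output δ).eq_empty_or_nonempty with hempty | hout
  -- With no critical edge, `N` retracts to its root, and so its retract `G` would be contractible.
  · refine absurd (DeformationRetractsOnto.contractibleSpace (p := r) ?_ hρ.retracts) hcontr
    have : spaceOf (∅ ∪ {{r}}) = {r} := by simp [spaceOf]
    rwa [hempty, this] at hdr
  · rwa [Set.union_eq_left.2 (Set.singleton_subset_iff.2 (hr hout))] at hdr
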